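/- Let $q>1$ and $s$ be real numbers with $qs\ge 1$. All systems are finite-dimensional. For a state (density matrix) $\rho$ put $S_{q,s}(\rho)=\frac{1}{(1-q)s}\left[(\mathrm{Tr}\,\rho^q)^s-1\right]$. For a bipartite pure state $|\psi\rangle$ of a system $AB$ put $E_{q,s}(|\psi\rangle)=S_{q,s}(\rho^A)$, where $\rho^A=\mathrm{Tr}_B|\psi\rangle\langle\psi|$, and for an arbitrary state $\rho$ of $AB$ put $$E_{q,s}(\rho)=\min\sum_j p_jE_{q,s}(|\psi_j\rangle),$$ where the minimum is over all finite pure-state ensembles $\{p_j,|\psi_j\rangle\}$ with $\rho=\sum_jp_j|\psi_j\rangle\langle\psi_j|$. Then the minimum is attained for every state, and the following hold. 1. (Continuity) $E_{q,s}$ is continuous on the set of states of every bipartite system $AB$. 2. (Entanglement monotone) $E_{q,s}$ is nonnegative; it vanishes on separable states, i.e. on finite convex combinations of product states; $E_{q,s}(\varepsilon(\rho))\le E_{q,s}(\rho)$ for every state $\rho$ and every map $\varepsilon$ implemented by local operations and classical communication (LOCC) with finitely many rounds, where the output system may differ from the input system; it is a convex function on the states of every $AB$; and it does not increase on average under LOCC: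 if an LOCC protocol converts $\rho$ to $\rho_j$ with probability $p_j$, then $\sum_jp_jE_{q,s}(\rho_j)\le E_{q,s}(\rho)$. 3. (Monogamy) For every tripartite state $\rho^{ABC}$ that satisfies the disentangling condition $E_{q,s}(\rho^{A|BC})=E_{q,s}(\rho^{AB})$, one has $E_{q,s}(\rho^{AC})=0$. Here $\rho^{AB}$ and $\rho^{AC}$ are the reduced states, and $E_{q,s}(\rho^{A|BC})$ is taken across the bipartition of $ABC$ into $A$ and $BC$. -/

import Mathlib

open scoped Kronecker ComplexOrder

universe u

namespace UnifiedEntanglement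

noncomputable section

/-- A (normalized) state of a finite-dimensional system with computational basis `X`:
a positive semidefinite matrix of trace one. -/
def IsState {X : Type u} [Fintype X] (ρ : Matrix X X ℂ) : Prop :=
  ρ.PosSemidef ∧ ρ.trace = 1

/-- A unit vector of `ℂ^X`. -/
def IsUnitVector {X : Type u} [Fintype X] (ψ : X → ℂ) : Prop :=
  dotProduct (star ψ) ψ = 1

/-- The rank-one operator `|ψ⟩⟨ψ|`. -/
def ketbra {X : Type u} (ψ : X → ℂ) : Matrix X X ℂ :=
  Matrix.vecMulVec ψ (star ψ)

/-- Partial trace over the second factor of `A × B`. -/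
def traceRight {A B : Type u} [Fintype B] (ρ : Matrix (A × B) (A × B) ℂ) : Matrix A A ℂ :=
  Matrix.of fun a a' => ∑ b, ρ (a, b) (a', b)

/-- The reduction of a tripartite state on `ABC` to `AB`. -/
def reduceAB {A B C : Type u} [Fintype C]
    (ρ : Matrix (A × (B × C)) (A × (B × C)) ℂ) : Matrix (A × B) (A × B) ℂ :=
  Matrix.of fun x y => ∑ c, ρ (x.1, (x.2, c)) (y.1, (y.2, c))

/-- The reduction of a tripartite state on `ABC` to `AC`. -/
def reduceAC {A B C : Type u} [Fintype B]
    (ρ : Matrix (A × (B × C)) (A × (B × C)) ℂ) : Matrix (A × C) (A × C) ℂ :=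
  Matrix.of fun x y => ∑ b, ρ (x.1, (b, x.2)) (y.1, (b, y.2))

/-- The unified entropy `S_{q,s}(ρ) = ((Tr ρ^q)^s - 1) / ((1 - q) s)`; the power `ρ^q` is taken
by functional calculus of the Hermitian matrix `ρ`. -/
def unifiedEntropy {X : Type u} [Fintype X] [DecidableEq X] (q s : ℝ) (ρ : Matrix X X ℂ) : ℝ :=
  1 / ((1 - q) * s) * (((cfc (fun x : ℝ => x ^ q) ρ).trace.re) ^ s - 1)

/-- `p`, `ψ` is a (finite) pure-state ensemble of `ρ`. -/
def IsPureEnsemble {X : Type u} [Fintype X] {n : ℕ} (p : Fin n → ℝ) (ψ : Fin n → X → ℂ)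
    (ρ : Matrix X X ℂ) : Prop :=
  (∀ j, 0 ≤ p j) ∧ ∑ j, p j = 1 ∧ (∀ j, IsUnitVector (ψ j)) ∧
    ∑ j, (p j : ℂ) • ketbra (ψ j) = ρ

/-- The set of averages `∑ p_j f(ψ_j)` over all pure-state ensembles of `ρ`. -/
def ensembleAverages {X : Type u} [Fintype X] (f : (X → ℂ) → ℝ) (ρ : Matrix X X ℂ) : Set ℝ :=
  {x | ∃ (n : ℕ) (p : Fin n → ℝ) (ψ : Fin n → X → ℂ),
    IsPureEnsemble p ψ ρ ∧ x = ∑ j, p j * f (ψ j)}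

/-- The convex-roof extension of a function on pure states. -/
def convexRoof {X : Type u} [Fintype X] (f : (X → ℂ) → ℝ) (ρ : Matrix X X ℂ) : ℝ :=
  sInf (ensembleAverages f ρ)

/-- The unified-`(q,s)` entropy entanglement of a pure state: the unified entropy of its
reduction to `A`. -/
def pureUnifiedEntanglement (q s : ℝ) {A B : Type u} [Fintype A] [DecidableEq A] [Fintype B]
    (ψ : A × B → ℂ) : ℝ :=
  unifiedEntropy q s (traceRight (ketbra ψ))

/-- A real-valued function of the states of all finite-dimensional bipartite systems
(only its values at states matter). -/
abbrev BipartiteFunction : Type (u + 1) :=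
  ∀ (A B : Type u) [Fintype A] [DecidableEq A] [Fintype B] [DecidableEq B],
    Matrix (A × B) (A × B) ℂ → ℝ

/-- The unified-`(q,s)` entropy entanglement `E_{q,s}`. -/
def unifiedEntanglement (q s : ℝ) : BipartiteFunction.{u} :=
  fun A B _ _ _ _ ρ => convexRoof (pureUnifiedEntanglement q s (A := A) (B := B)) ρ

/-- Separable states: finite convex combinations of product states. -/
def IsSeparable {A B : Type u} [Fintype A] [Fintype B]
    (ρ : Matrix (A × B) (A × B) ℂ) : Prop :=
  ∃ (n : ℕ) (p : Fin n → ℝ) (α : Fin n → Matrix A A ℂ) (β : Fin n → Matrix B B ℂ),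
    (∀ j, 0 ≤ p j) ∧ ∑ j, p j = 1 ∧ (∀ j, IsState (α j)) ∧ (∀ j, IsState (β j)) ∧
      ρ = ∑ j, (p j : ℂ) • (α j ⊗ₖ β j)

/-- The map `X ↦ V X V†`. -/
def conjMap {X Y : Type u} [Fintype X] (V : Matrix Y X ℂ) :
    Matrix X X ℂ →ₗ[ℂ] Matrix Y Y ℂ where
  toFun M := V * M * V.conjTranspose
  map_add' M N := by rw [Matrix.mul_add, Matrix.add_mul]
  map_smul' c M := by simp

/-- LOCC instruments from `AB` to `A'B'`, with finitely many rounds: families of maps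
`𝓔 j : L(AB) → L(A'B')`, one for every classical outcome `j`. Either nothing is done; or one of
the parties performs a local measurement with Kraus operators `V k` (the output system may depend
on the outcome, and may be larger or smaller than the input system), announces the result `k`,
and the parties continue with an LOCC instrument depending on `k`; or part of the classical
information is forgotten. General local instruments, local ancillas, partial traces and shared
randomness are all covered by this. -/
inductive IsLOCC {A' B' : Type u} [Fintype A'] [DecidableEq A'] [Fintype B'] [DecidableEq B'] :
    ∀ {A B : Type u} [Fintype A] [DecidableEq A] [Fintype B] [DecidableEq B]
      {J : Type} [Fintype J],
      (J → (Matrix (A × B) (A × B) ℂ →ₗ[ℂ] Matrix (A' × B') (A' × B') ℂ)) → Prop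
  | nothing : IsLOCC (A := A') (B := B') (J := Unit) (fun _ => LinearMap.id)
  | alice {A B : Type u} [Fintype A] [DecidableEq A] [Fintype B] [DecidableEq B]
      {K : Type} [Fintype K] {C : K → Type u} [∀ k, Fintype (C k)] [∀ k, DecidableEq (C k)]
      {J : K → Type} [∀ k, Fintype (J k)]
      (V : ∀ k, Matrix (C k) A ℂ) (hV : ∑ k, (V k).conjTranspose * V k = 1)
      (𝓔 : ∀ k, J k →
        (Matrix (C k × B) (C k × B) ℂ →ₗ[ℂ] Matrix (A' × B') (A' × B') ℂ))
      (h𝓔 : ∀ k, IsLOCC (𝓔 k)) :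
      IsLOCC (J := Σ k, J k)
        (fun x => 𝓔 x.1 x.2 ∘ₗ conjMap (V x.1 ⊗ₖ (1 : Matrix B B ℂ)))
  | bob {A B : Type u} [Fintype A] [DecidableEq A] [Fintype B] [DecidableEq B]
      {K : Type} [Fintype K] {D : K → Type u} [∀ k, Fintype (D k)] [∀ k, DecidableEq (D k)]
      {J : K → Type} [∀ k, Fintype (J k)]
      (V : ∀ k, Matrix (D k) B ℂ) (hV : ∑ k, (V k).conjTranspose * V k = 1)
      (𝓔 : ∀ k, J k →
        (Matrix (A × D k) (A × D k) ℂ →ₗ[ℂ] Matrix (A' × B') (A' × B') ℂ))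
      (h𝓔 : ∀ k, IsLOCC (𝓔 k)) :
      IsLOCC (J := Σ k, J k)
        (fun x => 𝓔 x.1 x.2 ∘ₗ conjMap ((1 : Matrix A A ℂ) ⊗ₖ V x.1))
  | forget {A B : Type u} [Fintype A] [DecidableEq A] [Fintype B] [DecidableEq B]
      {J J' : Type} [Fintype J] [Fintype J'] [DecidableEq J'] (f : J → J')
      (𝓔 : J → (Matrix (A × B) (A × B) ℂ →ₗ[ℂ] Matrix (A' × B') (A' × B') ℂ))
      (h𝓔 : IsLOCC 𝓔) :
      IsLOCC (fun j' => ∑ j with f j = j', 𝓔 j)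

/-- A (deterministic) LOCC map: an LOCC instrument with a single outcome. -/
def IsLOCCMap {A B A' B' : Type u} [Fintype A] [DecidableEq A] [Fintype B] [DecidableEq B]
    [Fintype A'] [DecidableEq A'] [Fintype B'] [DecidableEq B']
    (Φ : Matrix (A × B) (A × B) ℂ →ₗ[ℂ] Matrix (A' × B') (A' × B') ℂ) : Prop :=
  IsLOCC (fun _ : Unit => Φ)

/-- Bipartite entanglement measures: nonnegative functions that vanish on separable states and do
not increase under LOCC maps. -/
structure IsEntanglementMeasure (E : BipartiteFunction.{u}) : Prop where
  nonneg : ∀ (A B : Type u) [Fintype A] [DecidableEq A] [Fintype B] [DecidableEq B]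
    (ρ : Matrix (A × B) (A × B) ℂ), IsState ρ → 0 ≤ E A B ρ
  separable : ∀ (A B : Type u) [Fintype A] [DecidableEq A] [Fintype B] [DecidableEq B]
    (ρ : Matrix (A × B) (A × B) ℂ), IsSeparable ρ → E A B ρ = 0
  locc : ∀ (A B A' B' : Type u) [Fintype A] [DecidableEq A] [Fintype B] [DecidableEq B]
    [Fintype A'] [DecidableEq A'] [Fintype B'] [DecidableEq B']
    (Φ : Matrix (A × B) (A × B) ℂ →ₗ[ℂ] Matrix (A' × B') (A' × B') ℂ), IsLOCCMap Φ →
    ∀ ρ : Matrix (A × B) (A × B) ℂ, IsState ρ → E A' B' (Φ ρ) ≤ E A B ρ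

/-- Entanglement monotones: convex entanglement measures that do not increase on average
under LOCC. -/
structure IsEntanglementMonotone (E : BipartiteFunction.{u}) : Prop
    extends IsEntanglementMeasure E where
  convex : ∀ (A B : Type u) [Fintype A] [DecidableEq A] [Fintype B] [DecidableEq B],
    ConvexOn ℝ {ρ : Matrix (A × B) (A × B) ℂ | IsState ρ} (E A B)
  average : ∀ (A B A' B' : Type u) [Fintype A] [DecidableEq A] [Fintype B] [DecidableEq B]
    [Fintype A'] [DecidableEq A'] [Fintype B'] [DecidableEq B'] (J : Type) [Fintype J]
    (𝓔 : J → (Matrix (A × B) (A × B) ℂ →ₗ[ℂ] Matrix (A' × B') (A' × B') ℂ)), IsLOCC 𝓔 →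
    ∀ (ρ : Matrix (A × B) (A × B) ℂ) (p : J → ℝ) (σ : J → Matrix (A' × B') (A' × B') ℂ),
      IsState ρ → (∀ j, 0 ≤ p j) → (∀ j, IsState (σ j)) → (∀ j, 𝓔 j ρ = (p j : ℂ) • σ j) →
      ∑ j, p j * E A' B' (σ j) ≤ E A B ρ

/-- Continuity on the states of every finite-dimensional bipartite system. -/
def IsContinuous (E : BipartiteFunction.{u}) : Prop :=
  ∀ (A B : Type u) [Fintype A] [DecidableEq A] [Fintype B] [DecidableEq B],
    ContinuousOn (E A B) {ρ : Matrix (A × B) (A × B) ℂ | IsState ρ}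

/-- Monogamy: the disentangling condition `E(A|BC) = E(AB)` implies `E(AC) = 0`. -/
def IsMonogamous (E : BipartiteFunction.{u}) : Prop :=
  ∀ (A B C : Type u) [Fintype A] [DecidableEq A] [Fintype B] [DecidableEq B]
    [Fintype C] [DecidableEq C] (ρ : Matrix (A × (B × C)) (A × (B × C)) ℂ), IsState ρ →
    E A (B × C) ρ = E A B (reduceAB ρ) → E A C (reduceAC ρ) = 0

end

end UnifiedEntanglement

set_option linter.unusedSectionVars false

namespace UnifiedEntanglement

/-! ### The trace of a power of a positive semidefinite matrix -/

/-! Everything rests on strict concavity of `S_{q,s}`. The Peierls inequality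
`sum_diag_rpow_le_powTrace` reduces convexity of `Tr ρ^q` to scalar convexity in an eigenbasis of
the mixture. Normalising by the Schatten `q`-norm and using convexity of `t ↦ t^(qs)` for `qs ≥ 1`
passes to `(Tr ρ^q)^s`. Strictness survives even at `qs = 1`, because distinct states have trace one
and are never proportional.

Extending the entropy homogeneously to unnormalised operators (`homEntropy`) turns concavity into
superadditivity, with equality only for proportional operators (`homEntropy_add`). The convex roof
is then governed by the additive cone `pureCone` generated by the pairs (`|φ⟩⟨φ|`, entanglement of
`φ`). Over a state, the cone coincides with the convex hull of the graph on unit vectors. That hull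
is compact, so the minimum exists, and `E(ρ)` is the least `x` with `(ρ, x)` in the cone.

Statements about `E` thus become statements about generators, propagated by additivity. For LOCC, a
local measurement splits the reduced operator of the other party into a sum, so superadditivity
gives monotonicity on average. Convexity is closure of the cone under sums and nonnegative scaling.

For monogamy, the disentangling condition passes to every vector `φ` of an optimal decomposition.
For each unit `v` in `C`, the component of `φ` along `v` splits off from the `AB` reduction. The
equality case of superadditivity then makes the conditional state of `A` independent of `v`, so the
`AC` reduction of `φ` is a product.

For continuity, sublevel sets are projections of compact sets, which gives lower semicontinuity. An
optimal decomposition at `ρ₀` is transported to nearby states by `√ρ` times a pseudo-inverse of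
`√ρ₀`, which gives upper semicontinuity. -/

/-- `Tr ρ^q`, by functional calculus. -/
noncomputable def powTrace {X : Type*} [Fintype X] [DecidableEq X] (q : ℝ) (ρ : Matrix X X ℂ) : ℝ :=
  (cfc (fun x : ℝ => x ^ q) ρ).trace.re

section powTrace

variable {X Y : Type*} [Fintype X] [DecidableEq X] [Fintype Y] [DecidableEq Y]

lemma cfc_eq_mul {ρ : Matrix X X ℂ} (h : ρ.IsHermitian) (f : ℝ → ℝ) :
    cfc f ρ = (h.eigenvectorUnitary : Matrix X X ℂ) *
      Matrix.diagonal (fun i => (f (h.eigenvalues i) : ℂ)) *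
      star (h.eigenvectorUnitary : Matrix X X ℂ) := by
  rw [h.cfc_eq, Matrix.IsHermitian.cfc, Unitary.conjStarAlgAut_apply]
  rfl

lemma spectral_eq_mul {ρ : Matrix X X ℂ} (h : ρ.IsHermitian) :
    ρ = (h.eigenvectorUnitary : Matrix X X ℂ) *
      Matrix.diagonal (fun i => (h.eigenvalues i : ℂ)) *
      star (h.eigenvectorUnitary : Matrix X X ℂ) := by
  conv_lhs => rw [h.spectral_theorem, Unitary.conjStarAlgAut_apply]
  rfl

lemma trace_cfc {ρ : Matrix X X ℂ} (h : ρ.IsHermitian) (f : ℝ → ℝ) :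
    (cfc f ρ).trace = ((∑ i, f (h.eigenvalues i) : ℝ) : ℂ) := by
  rw [cfc_eq_mul h, Matrix.trace_mul_comm, ← mul_assoc, Unitary.coe_star_mul_self, one_mul,
    Matrix.trace_diagonal]
  simp

lemma powTrace_eq_sum (q : ℝ) {ρ : Matrix X X ℂ} (h : ρ.IsHermitian) :
    powTrace q ρ = ∑ i, h.eigenvalues i ^ q := by
  rw [powTrace, trace_cfc h]
  exact Complex.ofReal_re _

/-- Makes `powTrace` a function of the characteristic polynomial alone, so that it can be compared
between matrices of different sizes. -/
lemma powTrace_eq_roots (q : ℝ) {ρ : Matrix X X ℂ} (h : ρ.IsHermitian) :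
    powTrace q ρ = (ρ.charpoly.roots.map (fun z : ℂ => z.re ^ q)).sum := by
  rw [powTrace_eq_sum q h, h.roots_charpoly_eq_eigenvalues, Multiset.map_map]
  rfl

/-- The characteristic polynomials of `M * N` and `N * M` agree up to powers of the variable, and
the extra zero roots contribute `0 ^ q = 0`. This is what equates the entropies of the two
reductions of a pure state. -/
lemma powTrace_mul_comm {q : ℝ} (hq : q ≠ 0) (M : Matrix X Y ℂ) (N : Matrix Y X ℂ)
    (h : (M * N).IsHermitian) (h' : (N * M).IsHermitian) :
    powTrace q (M * N) = powTrace q (N * M) := by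
  have key := congrArg Polynomial.roots (Matrix.charpoly_mul_comm' M N)
  rw [Polynomial.roots_mul (mul_ne_zero (pow_ne_zero _ Polynomial.X_ne_zero)
      (Matrix.charpoly_monic _).ne_zero),
    Polynomial.roots_mul (mul_ne_zero (pow_ne_zero _ Polynomial.X_ne_zero)
      (Matrix.charpoly_monic _).ne_zero), Polynomial.roots_pow, Polynomial.roots_pow,
    Polynomial.roots_X] at key
  have key2 := congrArg (fun m => (Multiset.map (fun z : ℂ => z.re ^ q) m).sum) key
  simpa [Multiset.map_nsmul, Multiset.sum_nsmul, Real.zero_rpow hq, ← powTrace_eq_roots q h,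
    ← powTrace_eq_roots q h'] using key2

lemma powTrace_unitary_conj {q : ℝ} (hq : q ≠ 0) {ρ : Matrix X X ℂ} (h : ρ.IsHermitian)
    {U : Matrix X X ℂ} (hU : U ∈ unitary (Matrix X X ℂ)) :
    powTrace q (star U * ρ * U) = powTrace q ρ := by
  have h1 : ρ * U * star U = ρ := by
    rw [mul_assoc, Unitary.mul_star_self_of_mem hU, mul_one]
  have h2 : (star U * (ρ * U)).IsHermitian := by
    rw [← mul_assoc]
    exact Matrix.isHermitian_conjTranspose_mul_mul U h
  rw [mul_assoc, powTrace_mul_comm hq (star U) (ρ * U) h2 (h1.symm ▸ h), h1]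

lemma powTrace_nonneg (q : ℝ) {ρ : Matrix X X ℂ} (h : ρ.PosSemidef) : 0 ≤ powTrace q ρ := by
  rw [powTrace_eq_sum q h.isHermitian]
  exact Finset.sum_nonneg fun i _ => Real.rpow_nonneg (h.eigenvalues_nonneg i) q

lemma powTrace_smul {q c : ℝ} (hc : 0 ≤ c) {ρ : Matrix X X ℂ} (h : ρ.PosSemidef) :
    powTrace q ((c : ℂ) • ρ) = c ^ q * powTrace q ρ := by
  have h1 : cfc (fun x : ℝ => (c * x) ^ q) ρ = cfc (fun x : ℝ => x ^ q) ((c : ℂ) • ρ) := by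
    -- Continuity is automatic: the spectrum is finite, hence discrete.
    have := cfc_comp_const_mul c (fun x : ℝ => x ^ q) ρ (by
      rw [continuousOn_iff_continuous_domRestrict]; fun_prop) h.isHermitian
    rw [this]
    congr 1
  rw [powTrace, ← h1, trace_cfc h.isHermitian, powTrace_eq_sum q h.isHermitian, Complex.ofReal_re,
    Finset.mul_sum]
  exact Finset.sum_congr rfl fun i _ => Real.mul_rpow hc (h.eigenvalues_nonneg i)

lemma trace_re_eq_sum {ρ : Matrix X X ℂ} (h : ρ.IsHermitian) :
    ρ.trace.re = ∑ i, h.eigenvalues i := by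
  rw [h.trace_eq_sum_eigenvalues]
  simp

lemma sum_normSq_row_eq_one {U : Matrix X X ℂ} (hU : U ∈ unitary (Matrix X X ℂ)) (i : X) :
    ∑ k, Complex.normSq (U i k) = 1 := by
  have h1 : U * star U = 1 := Unitary.mul_star_self_of_mem hU
  have h := congrFun (congrFun h1 i) i
  rw [Matrix.mul_apply, Matrix.one_apply_eq] at h
  have : ((∑ k, Complex.normSq (U i k) : ℝ) : ℂ) = 1 := by
    rw [← h]
    push_cast
    refine Finset.sum_congr rfl fun k _ => ?_
    rw [Matrix.star_apply, ← Complex.mul_conj]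
    rfl
  exact_mod_cast this

lemma sum_normSq_col_eq_one {U : Matrix X X ℂ} (hU : U ∈ unitary (Matrix X X ℂ)) (k : X) :
    ∑ i, Complex.normSq (U i k) = 1 := by
  have := sum_normSq_row_eq_one (Unitary.star_mem hU) k
  simpa [Matrix.star_apply] using this

/-- **Peierls' inequality** for the power function, with its equality case. -/
lemma sum_diag_rpow_le_powTrace {q : ℝ} (hq : 1 < q) {M : Matrix X X ℂ} (h : M.PosSemidef) :
    (∀ i, 0 ≤ (M i i).re) ∧ ∑ i, (M i i).re ^ q ≤ powTrace q M ∧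
      (powTrace q M ≤ ∑ i, (M i i).re ^ q → ∀ i j, i ≠ j → M i j = 0) := by
  set U : Matrix X X ℂ := (h.isHermitian.eigenvectorUnitary : Matrix X X ℂ) with hUdef
  have hU : U ∈ unitary (Matrix X X ℂ) := h.isHermitian.eigenvectorUnitary.2
  set d := h.isHermitian.eigenvalues with hd
  have hd0 : ∀ k, 0 ≤ d k := h.eigenvalues_nonneg
  have entry : ∀ i j, M i j = ∑ k, U i k * (d k : ℂ) * star (U j k) := by
    intro i j
    conv_lhs => rw [spectral_eq_mul h.isHermitian]
    rw [Matrix.mul_apply]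
    refine Finset.sum_congr rfl fun k _ => ?_
    rw [Matrix.mul_diagonal, Matrix.star_apply]
  have diag : ∀ i, (M i i).re = ∑ k, Complex.normSq (U i k) • d k := by
    intro i
    rw [entry, Complex.re_sum]
    refine Finset.sum_congr rfl fun k _ => ?_
    have : U i k * (d k : ℂ) * star (U i k) = ((Complex.normSq (U i k) * d k : ℝ) : ℂ) := by
      push_cast
      rw [← Complex.mul_conj]
      simp only [RCLike.star_def]
      ring
    rw [this, Complex.ofReal_re, smul_eq_mul]
  have sc := strictConvexOn_rpow hq
  have jensen : ∀ i, (M i i).re ^ q ≤ ∑ k, Complex.normSq (U i k) • d k ^ q := by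
    intro i
    rw [diag]
    exact sc.convexOn.map_sum_le (fun k _ => Complex.normSq_nonneg _)
      (sum_normSq_row_eq_one hU i) (fun k _ => hd0 k)
  have total : ∑ i, ∑ k, Complex.normSq (U i k) • d k ^ q = powTrace q M := by
    rw [Finset.sum_comm, powTrace_eq_sum q h.isHermitian]
    refine Finset.sum_congr rfl fun k _ => ?_
    rw [← Finset.sum_smul, sum_normSq_col_eq_one hU, one_smul]
  refine ⟨fun i => ?_, ?_, ?_⟩
  · rw [diag]
    exact Finset.sum_nonneg fun k _ => mul_nonneg (Complex.normSq_nonneg _) (hd0 k)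
  · rw [← total]
    exact Finset.sum_le_sum fun i _ => jensen i
  · intro hle i j hij
    -- Equality of the totals forces equality in Jensen for each row; strict convexity then makes
    -- the eigenvalues constant on the support of that row of `U`.
    have heq : ∀ i, (M i i).re ^ q = ∑ k, Complex.normSq (U i k) • d k ^ q := by
      have := (Finset.sum_eq_sum_iff_of_le fun i _ => jensen i).1
        (le_antisymm (Finset.sum_le_sum fun i _ => jensen i) (total ▸ hle))
      exact fun i => this i (Finset.mem_univ i)
    have hconst : ∀ k k', U i k ≠ 0 → U i k' ≠ 0 → d k = d k' := by
      have := (sc.map_sum_eq_iff_of_nonneg (t := Finset.univ) (w := fun k => Complex.normSq (U i k))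
        (p := d) (fun k _ => Complex.normSq_nonneg _)
        (sum_normSq_row_eq_one hU i) (fun k _ => hd0 k)).1 (by rw [← diag i, heq i])
      exact fun k k' hk hk' => this (Finset.mem_univ k) (by simpa using hk) (Finset.mem_univ k')
        (by simpa using hk')
    -- Row `i` of `U` lies in a single eigenspace, so the `i`-th basis vector is an eigenvector of
    -- `M` and orthogonality of the rows kills the off-diagonal entries.
    have : ∃ c : ℝ, ∀ k, U i k * (d k : ℂ) = c * U i k := by
      by_cases hz : ∃ k, U i k ≠ 0
      · obtain ⟨k₀, hk₀⟩ := hz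
        refine ⟨d k₀, fun k => ?_⟩
        by_cases hk : U i k = 0
        · simp [hk]
        · rw [hconst k k₀ hk hk₀, mul_comm]
      · push Not at hz
        exact ⟨0, fun k => by simp [hz k]⟩
    obtain ⟨c, hc⟩ := this
    rw [entry]
    have h1 : U * star U = 1 := Unitary.mul_star_self_of_mem hU
    have h0 := congrFun (congrFun h1 i) j
    rw [Matrix.mul_apply, Matrix.one_apply_ne hij] at h0
    calc ∑ k, U i k * (d k : ℂ) * star (U j k) = c * ∑ k, U i k * star U k j := by
          rw [Finset.mul_sum]
          exact Finset.sum_congr rfl fun k _ => by rw [hc, Matrix.star_apply, mul_assoc]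
      _ = 0 := by rw [h0, mul_zero]

/-- `ρ ↦ Tr ρ^q` is strictly convex on positive semidefinite matrices for `q > 1`. -/
lemma powTrace_strictConvex {q a b : ℝ} (hq : 1 < q) (ha : 0 < a) (hb : 0 < b) (hab : a + b = 1)
    {ρ σ : Matrix X X ℂ} (hρ : ρ.PosSemidef) (hσ : σ.PosSemidef) :
    powTrace q ((a : ℂ) • ρ + (b : ℂ) • σ) ≤ a * powTrace q ρ + b * powTrace q σ ∧
      (a * powTrace q ρ + b * powTrace q σ ≤ powTrace q ((a : ℂ) • ρ + (b : ℂ) • σ) → ρ = σ) := by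
  have hq0 : q ≠ 0 := by positivity
  have hτ : ((a : ℂ) • ρ + (b : ℂ) • σ).PosSemidef :=
    (hρ.smul (by exact_mod_cast ha.le)).add (hσ.smul (by exact_mod_cast hb.le))
  set τ := (a : ℂ) • ρ + (b : ℂ) • σ with hτdef
  set U : Matrix X X ℂ := (hτ.isHermitian.eigenvectorUnitary : Matrix X X ℂ) with hUdef
  have hU : U ∈ unitary (Matrix X X ℂ) := hτ.isHermitian.eigenvectorUnitary.2
  set d := hτ.isHermitian.eigenvalues with hd
  have hM : (star U * ρ * U).PosSemidef := hρ.conjTranspose_mul_mul_same U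
  have hN : (star U * σ * U).PosSemidef := hσ.conjTranspose_mul_mul_same U
  have hPM := powTrace_unitary_conj hq0 hρ.isHermitian hU
  have hPN := powTrace_unitary_conj hq0 hσ.isHermitian hU
  -- In an eigenbasis of the mixture, its eigenvalues are `a M_ii + b N_ii`. Scalar convexity bounds
  -- their powers, and Peierls bounds the diagonal sums of `M` and `N`.
  have hD : (a : ℂ) • (star U * ρ * U) + (b : ℂ) • (star U * σ * U) =
      Matrix.diagonal (fun i => (d i : ℂ)) := by
    have h1 : star U * τ * U = Matrix.diagonal (fun i => (d i : ℂ)) := by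
      rw [spectral_eq_mul hτ.isHermitian, ← hUdef, ← hd, mul_assoc, mul_assoc,
        Unitary.star_mul_self_of_mem hU, mul_one, ← mul_assoc, Unitary.star_mul_self_of_mem hU,
        one_mul]
    rw [← h1, hτdef, mul_add, add_mul]
    simp
  have hback : ∀ κ : Matrix X X ℂ, U * (star U * κ * U) * star U = κ := fun κ => by
    rw [mul_assoc, mul_assoc, mul_assoc, Unitary.mul_star_self_of_mem hU, mul_one, ← mul_assoc,
      Unitary.mul_star_self_of_mem hU, one_mul]
  set M := star U * ρ * U with hMdef
  set N := star U * σ * U with hNdef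
  obtain ⟨hM0, hMle, hMeq⟩ := sum_diag_rpow_le_powTrace hq hM
  obtain ⟨hN0, hNle, hNeq⟩ := sum_diag_rpow_le_powTrace hq hN
  have hdi : ∀ i, d i = a * (M i i).re + b * (N i i).re := by
    intro i
    have := congrArg Complex.re (congrFun (congrFun hD i) i)
    simpa using this.symm
  have sc := strictConvexOn_rpow hq
  have hstep : ∀ i, d i ^ q ≤ a * (M i i).re ^ q + b * (N i i).re ^ q := by
    intro i
    rw [hdi]
    exact sc.convexOn.2 (hM0 i) (hN0 i) ha.le hb.le hab
  have hsum : ∑ i, (a * (M i i).re ^ q + b * (N i i).re ^ q) =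
      a * ∑ i, (M i i).re ^ q + b * ∑ i, (N i i).re ^ q := by
    rw [Finset.sum_add_distrib, Finset.mul_sum, Finset.mul_sum]
  have hτs : powTrace q τ = ∑ i, d i ^ q := powTrace_eq_sum q hτ.isHermitian
  have hle1 : powTrace q τ ≤ a * ∑ i, (M i i).re ^ q + b * ∑ i, (N i i).re ^ q := by
    rw [hτs, ← hsum]
    exact Finset.sum_le_sum fun i _ => hstep i
  have hle2 := mul_le_mul_of_nonneg_left hMle ha.le
  have hle3 := mul_le_mul_of_nonneg_left hNle hb.le
  rw [← hPM, ← hPN]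
  refine ⟨by linarith, fun hge => ?_⟩
  -- Equality overall makes every intermediate inequality tight: `M` and `N` are diagonal by
  -- Peierls, and strict scalar convexity identifies their diagonals.
  have hMd := hMeq (le_of_mul_le_mul_left (by linarith) ha)
  have hNd := hNeq (le_of_mul_le_mul_left (by linarith) hb)
  have heq := (Finset.sum_eq_sum_iff_of_le fun i _ => hstep i).1
    (le_antisymm (Finset.sum_le_sum fun i _ => hstep i) (by rw [hsum, ← hτs]; linarith))
  have hdiag : ∀ i, (M i i).re = (N i i).re := by
    intro i
    by_contra hne
    have := sc.2 (hM0 i) (hN0 i) hne ha hb hab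
    have h2 := heq i (Finset.mem_univ i)
    rw [hdi] at h2
    exact absurd h2 this.ne
  have hMN : M = N := by
    ext i j
    by_cases hij : i = j
    · subst hij
      have h1 := hM.isHermitian.coe_re_apply_self i
      have h2 := hN.isHermitian.coe_re_apply_self i
      rw [← h1, ← h2]
      exact congrArg _ (hdiag i)
    · rw [hMd i j hij, hNd i j hij]
  rw [← hback ρ, ← hback σ, ← hMdef, ← hNdef, hMN]

end powTrace

/-! ### Concavity of the unified entropy -/

section entropy

variable {X Y : Type u} [Fintype X] [DecidableEq X] [Fintype Y] [DecidableEq Y]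

lemma exponent_pos {q s : ℝ} (hq : 1 < q) (hqs : 1 ≤ q * s) : 0 < s :=
  (pos_iff_pos_of_mul_pos (zero_lt_one.trans_le hqs)).1 (zero_lt_one.trans hq)

lemma unifiedEntropy_eq (q s : ℝ) (ρ : Matrix X X ℂ) :
    unifiedEntropy q s ρ = 1 / ((q - 1) * s) * (1 - powTrace q ρ ^ s) := by
  have : (1 - q) * s = -((q - 1) * s) := by ring
  rw [unifiedEntropy, powTrace, this, one_div_neg_eq_neg_one_div]
  ring

lemma IsState.sum_eigenvalues {ρ : Matrix X X ℂ} (h : IsState ρ) :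
    ∑ i, h.1.isHermitian.eigenvalues i = 1 := by
  rw [← trace_re_eq_sum, h.2, Complex.one_re]

lemma IsState.eigenvalues_le_one {ρ : Matrix X X ℂ} (h : IsState ρ) (i : X) :
    h.1.isHermitian.eigenvalues i ≤ 1 := by
  rw [← h.sum_eigenvalues]
  exact Finset.single_le_sum (fun j _ => h.1.eigenvalues_nonneg j) (Finset.mem_univ i)

lemma IsState.powTrace_le_one {q : ℝ} (hq : 1 < q) {ρ : Matrix X X ℂ} (h : IsState ρ) :
    powTrace q ρ ≤ 1 := by
  rw [powTrace_eq_sum q h.1.isHermitian, ← h.sum_eigenvalues]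
  refine Finset.sum_le_sum fun i _ => ?_
  simpa using Real.rpow_le_rpow_of_exponent_ge' (h.1.eigenvalues_nonneg i)
    (h.eigenvalues_le_one i) zero_le_one hq.le

lemma IsState.powTrace_pos (q : ℝ) {ρ : Matrix X X ℂ} (h : IsState ρ) : 0 < powTrace q ρ := by
  rw [powTrace_eq_sum q h.1.isHermitian]
  obtain ⟨i, -, hi⟩ : ∃ i ∈ Finset.univ, 0 < h.1.isHermitian.eigenvalues i := by
    by_contra! hc
    have := Finset.sum_nonpos hc
    rw [h.sum_eigenvalues] at this
    linarith
  exact Finset.sum_pos' (fun i _ => Real.rpow_nonneg (h.1.eigenvalues_nonneg i) q)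
    ⟨i, Finset.mem_univ i, Real.rpow_pos_of_pos hi q⟩

/-- Strict convexity of `ρ ↦ (Tr ρ^q)^s` on states, for `q > 1` and `q s ≥ 1`. -/
lemma powTrace_rpow_strictConvex {q s a b : ℝ} (hq : 1 < q) (hqs : 1 ≤ q * s) (ha : 0 < a)
    (hb : 0 < b) (hab : a + b = 1) {ρ σ : Matrix X X ℂ} (hρ : IsState ρ) (hσ : IsState σ) :
    powTrace q ((a : ℂ) • ρ + (b : ℂ) • σ) ^ s ≤ a * powTrace q ρ ^ s + b * powTrace q σ ^ s ∧
      (a * powTrace q ρ ^ s + b * powTrace q σ ^ s ≤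
        powTrace q ((a : ℂ) • ρ + (b : ℂ) • σ) ^ s → ρ = σ) := by
  have hq0 : 0 < q := by linarith
  have hs0 : 0 < s := exponent_pos hq hqs
  -- The Schatten `q`-norms of `ρ` and `σ`; `L` below is the Minkowski bound for the norm of the
  -- mixture.
  set m := powTrace q ρ ^ (1 / q) with hm
  set n := powTrace q σ ^ (1 / q) with hn
  have hPρ := hρ.powTrace_pos q
  have hPσ := hσ.powTrace_pos q
  have hm0 : 0 < m := Real.rpow_pos_of_pos hPρ _
  have hn0 : 0 < n := Real.rpow_pos_of_pos hPσ _
  have hmq : m ^ q = powTrace q ρ := by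
    rw [hm, ← Real.rpow_mul hPρ.le, one_div_mul_cancel hq0.ne', Real.rpow_one]
  have hnq : n ^ q = powTrace q σ := by
    rw [hn, ← Real.rpow_mul hPσ.le, one_div_mul_cancel hq0.ne', Real.rpow_one]
  set L := a * m + b * n with hL
  have hL0 : 0 < L := by positivity
  have hunit : ∀ (κ : Matrix X X ℂ) (k : ℝ), κ.PosSemidef → 0 < k → k ^ q = powTrace q κ →
      powTrace q (((k⁻¹ : ℝ) : ℂ) • κ) = 1 := by
    intro κ k hκ hk hkq
    rw [powTrace_smul (inv_nonneg.2 hk.le) hκ, ← hkq, Real.inv_rpow hk.le,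
      inv_mul_cancel₀ (Real.rpow_pos_of_pos hk q).ne']
  set ρ' := ((m⁻¹ : ℝ) : ℂ) • ρ with hρ'
  set σ' := ((n⁻¹ : ℝ) : ℂ) • σ with hσ'
  have hρ'psd : ρ'.PosSemidef := hρ.1.smul (by exact_mod_cast (inv_pos.2 hm0).le)
  have hσ'psd : σ'.PosSemidef := hσ.1.smul (by exact_mod_cast (inv_pos.2 hn0).le)
  have hPρ' : powTrace q ρ' = 1 := hunit ρ m hρ.1 hm0 hmq
  have hPσ' : powTrace q σ' = 1 := hunit σ n hσ.1 hn0 hnq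
  -- With these weights the mixture is `L` times a convex combination `τ'` of operators of unit
  -- `q`-norm.
  have ha' : 0 < a * m / L := by positivity
  have hb' : 0 < b * n / L := by positivity
  have hab' : a * m / L + b * n / L = 1 := by rw [← add_div, ← hL, div_self hL0.ne']
  obtain ⟨hc, hceq⟩ := powTrace_strictConvex hq ha' hb' hab' hρ'psd hσ'psd
  rw [hPρ', hPσ', mul_one, mul_one, hab'] at hc hceq
  set τ' := ((a * m / L : ℝ) : ℂ) • ρ' + ((b * n / L : ℝ) : ℂ) • σ' with hτ'
  have hτ'psd : τ'.PosSemidef :=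
    (hρ'psd.smul (by exact_mod_cast ha'.le)).add (hσ'psd.smul (by exact_mod_cast hb'.le))
  have hτ : (a : ℂ) • ρ + (b : ℂ) • σ = (L : ℂ) • τ' := by
    rw [hτ', hρ', hσ', smul_add, smul_smul, smul_smul, smul_smul, smul_smul]
    congr 2
    · rw [← Complex.ofReal_mul, ← Complex.ofReal_mul]
      congr 1
      field_simp
    · rw [← Complex.ofReal_mul, ← Complex.ofReal_mul]
      congr 1
      field_simp
  have hPτ : powTrace q ((a : ℂ) • ρ + (b : ℂ) • σ) ^ s = L ^ (q * s) * powTrace q τ' ^ s := by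
    rw [hτ, powTrace_smul hL0.le hτ'psd, Real.mul_rpow (Real.rpow_nonneg hL0.le q)
      (powTrace_nonneg q hτ'psd), ← Real.rpow_mul hL0.le]
  -- Convexity of `t ↦ t ^ (q * s)`: the place where `q * s ≥ 1` is essential.
  have hLr : L ^ (q * s) ≤ a * powTrace q ρ ^ s + b * powTrace q σ ^ s := by
    have := (convexOn_rpow hqs).2 (Set.mem_Ici.2 hm0.le) (Set.mem_Ici.2 hn0.le) ha.le hb.le hab
    simp only [smul_eq_mul] at this
    rwa [Real.rpow_mul hm0.le, Real.rpow_mul hn0.le, hmq, hnq] at this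
  have hLpos : 0 < L ^ (q * s) := Real.rpow_pos_of_pos hL0 _
  have hle1 : powTrace q τ' ^ s ≤ 1 := Real.rpow_le_one (powTrace_nonneg q hτ'psd) hc hs0.le
  rw [hPτ]
  refine ⟨by nlinarith, fun hge => ?_⟩
  have h1 : 1 ≤ powTrace q τ' ^ s := by
    by_contra! hlt
    have := mul_lt_mul_of_pos_left hlt hLpos
    linarith
  have h2 : 1 ≤ powTrace q τ' := by
    by_contra! hlt
    exact absurd h1 (not_le.2 (Real.rpow_lt_one (powTrace_nonneg q hτ'psd) hlt hs0))
  have h3 : ρ' = σ' := hceq h2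
  -- Equality has only shown `ρ` and `σ` to be proportional; their unit traces make the factors
  -- agree.
  have h4 : (m⁻¹ : ℝ) = n⁻¹ := by
    have := congrArg Matrix.trace h3
    rw [hρ', hσ', Matrix.trace_smul, Matrix.trace_smul, hρ.2, hσ.2] at this
    simpa using this
  rw [hρ', hσ', ← h4] at h3
  exact smul_right_injective _ (by exact_mod_cast (inv_pos.2 hm0).ne') h3

lemma coeff_pos {q s : ℝ} (hq : 1 < q) (hqs : 1 ≤ q * s) : 0 < 1 / ((q - 1) * s) := by
  have hq0 : 0 < q := by linarith
  have hs0 : 0 < s := exponent_pos hq hqs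
  have : 0 < q - 1 := by linarith
  positivity

/-- Strict concavity of the unified entropy. -/
lemma unifiedEntropy_strictConcave {q s a b : ℝ} (hq : 1 < q) (hqs : 1 ≤ q * s) (ha : 0 < a)
    (hb : 0 < b) (hab : a + b = 1) {ρ σ : Matrix X X ℂ} (hρ : IsState ρ) (hσ : IsState σ) :
    a * unifiedEntropy q s ρ + b * unifiedEntropy q s σ ≤
        unifiedEntropy q s ((a : ℂ) • ρ + (b : ℂ) • σ) ∧
      (unifiedEntropy q s ((a : ℂ) • ρ + (b : ℂ) • σ) ≤
        a * unifiedEntropy q s ρ + b * unifiedEntropy q s σ → ρ = σ) := by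
  obtain ⟨h1, h2⟩ := powTrace_rpow_strictConvex hq hqs ha hb hab hρ hσ
  have hc := coeff_pos hq hqs
  simp only [unifiedEntropy_eq]
  generalize 1 / ((q - 1) * s) = c at hc
  have key : a * (c * (1 - powTrace q ρ ^ s)) + b * (c * (1 - powTrace q σ ^ s)) =
      c * (1 - (a * powTrace q ρ ^ s + b * powTrace q σ ^ s)) := by
    linear_combination c * hab
  rw [key]
  refine ⟨mul_le_mul_of_nonneg_left (by linarith) hc.le, fun h => h2 ?_⟩
  linarith [le_of_mul_le_mul_left h hc]

lemma unifiedEntropy_nonneg {q s : ℝ} (hq : 1 < q) (hqs : 1 ≤ q * s) {ρ : Matrix X X ℂ}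
    (h : IsState ρ) : 0 ≤ unifiedEntropy q s ρ := by
  have hs0 : 0 < s := exponent_pos hq hqs
  rw [unifiedEntropy_eq]
  exact mul_nonneg (coeff_pos hq hqs).le (sub_nonneg.2
    (Real.rpow_le_one (h.powTrace_pos q).le (h.powTrace_le_one hq) hs0.le))

lemma unifiedEntropy_le {q s : ℝ} (hq : 1 < q) (hqs : 1 ≤ q * s) {ρ : Matrix X X ℂ}
    (h : IsState ρ) : unifiedEntropy q s ρ ≤ 1 / ((q - 1) * s) := by
  rw [unifiedEntropy_eq]
  have := Real.rpow_nonneg (h.powTrace_pos q).le s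
  exact mul_le_of_le_one_right (coeff_pos hq hqs).le (by linarith)

lemma ketbra_posSemidef {X : Type*} [Fintype X] (ψ : X → ℂ) : (ketbra ψ).PosSemidef :=
  Matrix.posSemidef_vecMulVec_self_star ψ

lemma trace_ketbra {X : Type*} [Fintype X] (ψ : X → ℂ) :
    (ketbra ψ).trace = dotProduct (star ψ) ψ := by
  rw [ketbra, Matrix.trace_vecMulVec, dotProduct_comm]

lemma powTrace_one_unit (q : ℝ) : powTrace q (1 : Matrix Unit Unit ℂ) = 1 := by
  rw [powTrace, cfc_apply_one]
  simp

lemma powTrace_ketbra {q : ℝ} (hq : q ≠ 0) {ψ : X → ℂ} (h : IsUnitVector ψ) :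
    powTrace q (ketbra ψ) = 1 := by
  have h1 : Matrix.replicateRow Unit (star ψ) * Matrix.replicateCol Unit ψ = 1 := by
    ext i j
    simpa [Matrix.mul_apply, dotProduct, IsUnitVector] using h
  have h2 := (ketbra_posSemidef ψ).isHermitian
  rw [ketbra, Matrix.vecMulVec_eq Unit] at h2 ⊢
  rw [powTrace_mul_comm hq _ _ h2 (h1 ▸ Matrix.isHermitian_one), h1, powTrace_one_unit]

lemma unifiedEntropy_ketbra {q : ℝ} (hq : q ≠ 0) (s : ℝ) {ψ : X → ℂ} (h : IsUnitVector ψ) :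
    unifiedEntropy q s (ketbra ψ) = 0 := by
  rw [unifiedEntropy_eq, powTrace_ketbra hq h, Real.one_rpow, sub_self, mul_zero]

open scoped Matrix.Norms.L2Operator in
-- All states have spectrum in the fixed compact set `[0, 1]`, so continuity of the functional
-- calculus in the operator applies.
lemma continuousOn_cfc_states {f : ℝ → ℝ} (hf : ContinuousOn f (Set.Icc 0 1)) :
    ContinuousOn (fun ρ : Matrix X X ℂ => cfc f ρ) {ρ | IsState ρ} := by
  refine (continuousOn_cfc (Matrix X X ℂ) (p := IsSelfAdjoint) isCompact_Icc f hf).mono ?_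
  intro ρ hρ
  refine ⟨hρ.1.isHermitian, ?_⟩
  rw [hρ.1.isHermitian.spectrum_real_eq_range_eigenvalues]
  rintro _ ⟨i, rfl⟩
  exact ⟨hρ.1.eigenvalues_nonneg i, hρ.eigenvalues_le_one i⟩

lemma continuousOn_unifiedEntropy {q s : ℝ} (hq : 1 < q) (hqs : 1 ≤ q * s) :
    ContinuousOn (unifiedEntropy q s (X := X)) {ρ | IsState ρ} := by
  have hs0 : 0 < s := exponent_pos hq hqs
  have h1 : ContinuousOn (fun ρ : Matrix X X ℂ => cfc (fun x : ℝ => x ^ q) ρ) {ρ | IsState ρ} :=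
    continuousOn_cfc_states (Real.continuous_rpow_const (by linarith)).continuousOn
  have h2 : Continuous fun M : Matrix X X ℂ => M.trace.re :=
    Complex.continuous_re.comp continuous_id.matrix_trace
  exact continuousOn_const.mul
    (((Real.continuous_rpow_const hs0.le).comp_continuousOn
      (h2.comp_continuousOn h1)).sub continuousOn_const)

end entropy

/-! ### The homogeneous extension of the unified entropy -/

/-- The unified entropy extended to unnormalized states as a function homogeneous of degree one. -/
noncomputable def homEntropy {X : Type u} [Fintype X] [DecidableEq X] (q s : ℝ)
    (ρ : Matrix X X ℂ) : ℝ :=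
  ρ.trace.re * unifiedEntropy q s (((ρ.trace.re⁻¹ : ℝ) : ℂ) • ρ)

section homEntropy

variable {X Y : Type u} [Fintype X] [DecidableEq X] [Fintype Y] [DecidableEq Y] {q s : ℝ}

lemma PosSemidef.trace_re_nonneg {X : Type*} [Fintype X] {ρ : Matrix X X ℂ} (h : ρ.PosSemidef) :
    0 ≤ ρ.trace.re :=
  (Complex.le_def.1 h.trace_nonneg).1

lemma PosSemidef.coe_trace_re {X : Type*} [Fintype X] {ρ : Matrix X X ℂ} (h : ρ.PosSemidef) :
    ((ρ.trace.re : ℝ) : ℂ) = ρ.trace :=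
  Complex.ext rfl (Complex.le_def.1 h.trace_nonneg).2

lemma PosSemidef.eq_zero_of_trace_re {X : Type*} [Fintype X] {ρ : Matrix X X ℂ}
    (h : ρ.PosSemidef) (h0 : ρ.trace.re = 0) : ρ = 0 := by
  rw [← h.trace_eq_zero_iff, ← PosSemidef.coe_trace_re h, h0, Complex.ofReal_zero]

lemma PosSemidef.isState_normalize {X : Type u} [Fintype X] {ρ : Matrix X X ℂ} (h : ρ.PosSemidef)
    (h0 : ρ ≠ 0) : IsState (((ρ.trace.re⁻¹ : ℝ) : ℂ) • ρ) := by
  refine ⟨h.smul (by exact_mod_cast inv_nonneg.2 (PosSemidef.trace_re_nonneg h)), ?_⟩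
  rw [Matrix.trace_smul, smul_eq_mul, Complex.ofReal_inv, PosSemidef.coe_trace_re h]
  exact inv_mul_cancel₀ fun h1 => h0 (h.trace_eq_zero_iff.1 h1)

lemma IsState.ne_zero {X : Type u} [Fintype X] {ρ : Matrix X X ℂ} (h : IsState ρ) : ρ ≠ 0 := by
  rintro rfl
  have := h.2
  simp at this

lemma IsState.homEntropy_eq {ρ : Matrix X X ℂ} (h : IsState ρ) :
    homEntropy q s ρ = unifiedEntropy q s ρ := by
  simp [homEntropy, h.2]

lemma homEntropy_zero : homEntropy q s (0 : Matrix X X ℂ) = 0 := by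
  simp [homEntropy]

lemma homEntropy_smul {c : ℝ} (ρ : Matrix X X ℂ) :
    homEntropy q s ((c : ℂ) • ρ) = c * homEntropy q s ρ := by
  by_cases hc : c = 0
  · simp [hc, homEntropy_zero]
  · have h1 : ((c : ℂ) • ρ).trace.re = c * ρ.trace.re := by
      simp [Matrix.trace_smul]
    rw [homEntropy, homEntropy, h1, smul_smul, ← Complex.ofReal_mul, mul_inv, mul_assoc,
      mul_right_comm, inv_mul_cancel₀ hc, one_mul]

lemma homEntropy_nonneg (hq : 1 < q) (hqs : 1 ≤ q * s) {ρ : Matrix X X ℂ} (h : ρ.PosSemidef) :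
    0 ≤ homEntropy q s ρ := by
  by_cases h0 : ρ = 0
  · rw [h0, homEntropy_zero]
  · exact mul_nonneg (PosSemidef.trace_re_nonneg h)
      (unifiedEntropy_nonneg hq hqs (PosSemidef.isState_normalize h h0))

lemma homEntropy_le (hq : 1 < q) (hqs : 1 ≤ q * s) {ρ : Matrix X X ℂ} (h : ρ.PosSemidef) :
    homEntropy q s ρ ≤ ρ.trace.re * (1 / ((q - 1) * s)) := by
  by_cases h0 : ρ = 0
  · simp [h0, homEntropy_zero]
  · exact mul_le_mul_of_nonneg_left
      (unifiedEntropy_le hq hqs (PosSemidef.isState_normalize h h0)) (PosSemidef.trace_re_nonneg h)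

lemma homEntropy_congr {ρ : Matrix X X ℂ} {σ : Matrix Y Y ℂ} (hρ : ρ.PosSemidef)
    (hσ : σ.PosSemidef) (ht : ρ.trace = σ.trace) (hP : powTrace q ρ = powTrace q σ) :
    homEntropy q s ρ = homEntropy q s σ := by
  have h0 : 0 ≤ σ.trace.re⁻¹ := inv_nonneg.2 (PosSemidef.trace_re_nonneg hσ)
  rw [homEntropy, homEntropy, ht, unifiedEntropy_eq, unifiedEntropy_eq, powTrace_smul h0 hρ,
    powTrace_smul h0 hσ, hP]

/-- Superadditivity of the homogeneous entropy, with its equality case. -/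
lemma homEntropy_add (hq : 1 < q) (hqs : 1 ≤ q * s) {ρ σ : Matrix X X ℂ} (hρ : ρ.PosSemidef)
    (hσ : σ.PosSemidef) :
    homEntropy q s ρ + homEntropy q s σ ≤ homEntropy q s (ρ + σ) ∧
      (homEntropy q s (ρ + σ) ≤ homEntropy q s ρ + homEntropy q s σ →
        σ.trace • ρ = ρ.trace • σ) := by
  -- The cross-multiplied form of proportionality is trivially true when a summand vanishes.
  by_cases hρ0 : ρ = 0
  · simp [hρ0, homEntropy_zero]
  by_cases hσ0 : σ = 0
  · simp [hσ0, homEntropy_zero]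
  have hρs := PosSemidef.isState_normalize hρ hρ0
  have hσs := PosSemidef.isState_normalize hσ hσ0
  have htρ : 0 < ρ.trace.re := lt_of_le_of_ne (PosSemidef.trace_re_nonneg hρ)
    fun h => hρ0 (PosSemidef.eq_zero_of_trace_re hρ h.symm)
  have htσ : 0 < σ.trace.re := lt_of_le_of_ne (PosSemidef.trace_re_nonneg hσ)
    fun h => hσ0 (PosSemidef.eq_zero_of_trace_re hσ h.symm)
  rw [← PosSemidef.coe_trace_re hρ, ← PosSemidef.coe_trace_re hσ]
  rw [homEntropy, homEntropy, homEntropy, Matrix.trace_add, Complex.add_re]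
  set x := ρ.trace.re with hx
  set y := σ.trace.re with hy
  have hxy : 0 < x + y := by positivity
  obtain ⟨h1, h2⟩ := unifiedEntropy_strictConcave hq hqs (a := x / (x + y)) (b := y / (x + y))
    (by positivity) (by positivity) (by rw [← add_div, div_self hxy.ne']) hρs hσs
  have h3 : ((x / (x + y) : ℝ) : ℂ) • (((x⁻¹ : ℝ) : ℂ) • ρ) +
      ((y / (x + y) : ℝ) : ℂ) • (((y⁻¹ : ℝ) : ℂ) • σ) = (((x + y)⁻¹ : ℝ) : ℂ) • (ρ + σ) := by
    rw [smul_smul, smul_smul, smul_add, ← Complex.ofReal_mul, ← Complex.ofReal_mul]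
    congr 3
    · field_simp
    · field_simp
  rw [h3] at h1 h2
  have h4 : (x + y) * (x / (x + y) * unifiedEntropy q s (((x⁻¹ : ℝ) : ℂ) • ρ) +
      y / (x + y) * unifiedEntropy q s (((y⁻¹ : ℝ) : ℂ) • σ)) =
      x * unifiedEntropy q s (((x⁻¹ : ℝ) : ℂ) • ρ) +
        y * unifiedEntropy q s (((y⁻¹ : ℝ) : ℂ) • σ) := by
    field_simp
  rw [← h4]
  refine ⟨mul_le_mul_of_nonneg_left h1 hxy.le, fun h => ?_⟩
  have h5 := h2 (le_of_mul_le_mul_left h hxy)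
  have h6 := congrArg (fun M => ((x * y : ℝ) : ℂ) • M) h5
  simp only [smul_smul, ← Complex.ofReal_mul] at h6
  have h7 : x * y * x⁻¹ = y := by field_simp
  have h8 : x * y * y⁻¹ = x := by field_simp
  rwa [h7, h8] at h6

lemma homEntropy_sum (hq : 1 < q) (hqs : 1 ≤ q * s) {K : Type*} (t : Finset K)
    {ρ : K → Matrix X X ℂ} (hρ : ∀ k, (ρ k).PosSemidef) :
    ∑ k ∈ t, homEntropy q s (ρ k) ≤ homEntropy q s (∑ k ∈ t, ρ k) := by
  classical
  induction t using Finset.induction_on with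
  | empty => simp [homEntropy_zero]
  | insert a t ha ih =>
    rw [Finset.sum_insert ha, Finset.sum_insert ha]
    have := (homEntropy_add hq hqs (hρ a) (Matrix.posSemidef_sum t fun k _ => hρ k)).1
    linarith

lemma homEntropy_ketbra (hq : q ≠ 0) {ψ : X → ℂ} : homEntropy q s (ketbra ψ) = 0 := by
  by_cases h0 : ketbra ψ = 0
  · rw [h0, homEntropy_zero]
  · have h1 := PosSemidef.isState_normalize (ketbra_posSemidef ψ) h0
    have h2 : (((ketbra ψ).trace.re⁻¹ : ℝ) : ℂ) • ketbra ψ =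
        ketbra (((Real.sqrt ((ketbra ψ).trace.re⁻¹) : ℝ) : ℂ) • ψ) := by
      have h3 : 0 ≤ (ketbra ψ).trace.re⁻¹ :=
        inv_nonneg.2 (PosSemidef.trace_re_nonneg (ketbra_posSemidef ψ))
      conv_lhs => rw [← Real.mul_self_sqrt h3]
      ext i j
      simp [ketbra, Matrix.vecMulVec_apply]
      ring
    rw [homEntropy, h2, unifiedEntropy_ketbra hq, mul_zero]
    rw [h2] at h1
    rw [IsUnitVector, ← trace_ketbra]
    exact h1.2

end homEntropy

/-! ### Pure vectors of bipartite systems and the cone of decompositions -/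

section pure

/-- The coefficient matrix of a bipartite vector. -/
def coeffMatrix {A B : Type*} (φ : A × B → ℂ) : Matrix A B ℂ :=
  Matrix.of fun a b => φ (a, b)

/-- The entanglement of a pure state, extended homogeneously to unnormalized vectors. -/
noncomputable def pureHom (q s : ℝ) {A B : Type u} [Fintype A] [DecidableEq A] [Fintype B]
    (φ : A × B → ℂ) : ℝ :=
  homEntropy q s (traceRight (ketbra φ))

variable {A B C : Type u} [Fintype A] [DecidableEq A] [Fintype B] [DecidableEq B]
  [Fintype C] [DecidableEq C] {q s : ℝ}

lemma traceRight_ketbra {A B : Type u} [Fintype B] (φ : A × B → ℂ) :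
    traceRight (ketbra φ) = coeffMatrix φ * (coeffMatrix φ).conjTranspose := by
  ext a a'
  simp [traceRight, ketbra, coeffMatrix, Matrix.mul_apply, Matrix.vecMulVec_apply]

lemma trace_traceRight {A B : Type u} [Fintype A] [Fintype B] (ρ : Matrix (A × B) (A × B) ℂ) :
    (traceRight ρ).trace = ρ.trace := by
  simp [Matrix.trace, traceRight, Fintype.sum_prod_type]

lemma traceRight_ketbra_posSemidef {A B : Type u} [Fintype A] [Fintype B] (φ : A × B → ℂ) :
    (traceRight (ketbra φ)).PosSemidef := by
  rw [traceRight_ketbra]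
  exact Matrix.posSemidef_self_mul_conjTranspose _

lemma pureHom_eq_right (φ : A × B → ℂ) :
    pureHom q s φ = homEntropy q s (coeffMatrix φ * (coeffMatrix φ).conjTranspose) := by
  rw [pureHom, traceRight_ketbra]

/-- The entanglement may be computed from either party. `Mᴴ M` is the transpose of the reduction to
`B`, which is the convenient side when `A` is measured. -/
lemma pureHom_eq_left (hq : q ≠ 0) (φ : A × B → ℂ) :
    pureHom q s φ = homEntropy q s ((coeffMatrix φ).conjTranspose * coeffMatrix φ) := by
  rw [pureHom_eq_right]
  have h1 := Matrix.posSemidef_self_mul_conjTranspose (coeffMatrix φ)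
  have h2 := Matrix.posSemidef_conjTranspose_mul_self (coeffMatrix φ)
  exact homEntropy_congr h1 h2 (Matrix.trace_mul_comm _ _)
    (powTrace_mul_comm hq _ _ h1.isHermitian h2.isHermitian)

lemma pureHom_nonneg (hq : 1 < q) (hqs : 1 ≤ q * s) (φ : A × B → ℂ) : 0 ≤ pureHom q s φ :=
  homEntropy_nonneg hq hqs (traceRight_ketbra_posSemidef φ)

lemma ketbra_smul {X : Type*} (c : ℝ) (φ : X → ℂ) :
    ketbra ((c : ℂ) • φ) = ((c ^ 2 : ℝ) : ℂ) • ketbra φ := by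
  ext i j
  simp [ketbra, Matrix.vecMulVec_apply]
  ring

lemma ketbra_sqrt_smul {X : Type*} {c : ℝ} (hc : 0 ≤ c) (φ : X → ℂ) :
    ketbra (((√c : ℝ) : ℂ) • φ) = (c : ℂ) • ketbra φ := by
  rw [ketbra_smul, Real.sq_sqrt hc]

lemma traceRight_smul {A B : Type u} [Fintype B] (c : ℂ) (ρ : Matrix (A × B) (A × B) ℂ) :
    traceRight (c • ρ) = c • traceRight ρ := by
  ext a a'
  simp [traceRight, Finset.mul_sum]

lemma pureHom_sqrt_smul {c : ℝ} (hc : 0 ≤ c) (φ : A × B → ℂ) :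
    pureHom q s (((√c : ℝ) : ℂ) • φ) = c * pureHom q s φ := by
  rw [pureHom, ketbra_sqrt_smul hc, traceRight_smul, homEntropy_smul, pureHom]

lemma IsUnitVector.isState_ketbra {X : Type u} [Fintype X] {ψ : X → ℂ} (h : IsUnitVector ψ) :
    IsState (ketbra ψ) :=
  ⟨ketbra_posSemidef ψ, by rw [trace_ketbra]; exact h⟩

lemma IsUnitVector.isState_traceRight {A B : Type u} [Fintype A] [Fintype B] {ψ : A × B → ℂ}
    (h : IsUnitVector ψ) : IsState (traceRight (ketbra ψ)) :=
  ⟨traceRight_ketbra_posSemidef ψ, by rw [trace_traceRight, h.isState_ketbra.2]⟩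

lemma IsUnitVector.pureHom_eq {ψ : A × B → ℂ} (h : IsUnitVector ψ) :
    pureHom q s ψ = pureUnifiedEntanglement q s ψ :=
  h.isState_traceRight.homEntropy_eq

lemma ketbra_mulVec {X Y : Type*} [Fintype X] (V : Matrix Y X ℂ) (φ : X → ℂ) :
    ketbra (V.mulVec φ) = V * ketbra φ * V.conjTranspose := by
  rw [ketbra, ketbra, Matrix.mul_vecMulVec, Matrix.vecMulVec_mul, Matrix.star_mulVec]

lemma conjMap_ketbra {X Y : Type u} [Fintype X] (V : Matrix Y X ℂ) (φ : X → ℂ) :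
    conjMap V (ketbra φ) = ketbra (V.mulVec φ) :=
  (ketbra_mulVec V φ).symm

lemma coeffMatrix_kronecker_one (V : Matrix C A ℂ) (φ : A × B → ℂ) :
    coeffMatrix ((V ⊗ₖ (1 : Matrix B B ℂ)).mulVec φ) = V * coeffMatrix φ := by
  ext c b
  simp [coeffMatrix, Matrix.mulVec, dotProduct, Matrix.mul_apply, Fintype.sum_prod_type,
    Matrix.one_apply, Matrix.kroneckerMap_apply]

lemma coeffMatrix_one_kronecker (V : Matrix C B ℂ) (φ : A × B → ℂ) :
    coeffMatrix (((1 : Matrix A A ℂ) ⊗ₖ V).mulVec φ) = coeffMatrix φ * V.transpose := by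
  ext a c
  simp [coeffMatrix, Matrix.mulVec, dotProduct, Matrix.mul_apply, Fintype.sum_prod_type,
    Matrix.one_apply, Matrix.kroneckerMap_apply, mul_comm]

/-- A local measurement of the first party does not increase the entanglement of a pure state on
average. -/
lemma sum_pureHom_left_le (hq : 1 < q) (hqs : 1 ≤ q * s) {K : Type*} [Fintype K]
    {C : K → Type u} [∀ k, Fintype (C k)] [∀ k, DecidableEq (C k)]
    (V : ∀ k, Matrix (C k) A ℂ) (hV : ∑ k, (V k).conjTranspose * V k = 1) (φ : A × B → ℂ) :
    ∑ k, pureHom q s ((V k ⊗ₖ (1 : Matrix B B ℂ)).mulVec φ) ≤ pureHom q s φ := by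
  have hq0 : q ≠ 0 := by positivity
  -- By completeness of the Kraus operators, a measurement of `A` splits the reduced operator on the
  -- side of `B` into a sum.
  have h1 : (coeffMatrix φ).conjTranspose * coeffMatrix φ =
      ∑ k, (V k * coeffMatrix φ).conjTranspose * (V k * coeffMatrix φ) := by
    simp only [Matrix.conjTranspose_mul, Matrix.mul_assoc]
    rw [← Matrix.mul_sum]
    simp only [← Matrix.mul_assoc (V _).conjTranspose]
    rw [← Matrix.sum_mul, hV, Matrix.one_mul]
  simp only [pureHom_eq_left hq0, coeffMatrix_kronecker_one]
  rw [h1]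
  exact homEntropy_sum hq hqs _ fun k => Matrix.posSemidef_conjTranspose_mul_self _

/-- A local measurement of the second party does not increase the entanglement of a pure state on
average. -/
lemma sum_pureHom_right_le (hq : 1 < q) (hqs : 1 ≤ q * s) {K : Type*} [Fintype K]
    {D : K → Type u} [∀ k, Fintype (D k)] [∀ k, DecidableEq (D k)]
    (V : ∀ k, Matrix (D k) B ℂ) (hV : ∑ k, (V k).conjTranspose * V k = 1) (φ : A × B → ℂ) :
    ∑ k, pureHom q s (((1 : Matrix A A ℂ) ⊗ₖ V k).mulVec φ) ≤ pureHom q s φ := by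
  -- Operators on `B` act on the coefficient matrix from the right and transposed, so the
  -- completeness relation is needed in transposed form.
  have hV' : ∑ k, (V k).transpose * (V k).transpose.conjTranspose = 1 := by
    have := congrArg Matrix.transpose hV
    rw [Matrix.transpose_sum, Matrix.transpose_one] at this
    rw [← this]
    refine Finset.sum_congr rfl fun k _ => ?_
    rw [Matrix.transpose_mul]
    rfl
  have h1 : coeffMatrix φ * (coeffMatrix φ).conjTranspose =
      ∑ k, (coeffMatrix φ * (V k).transpose) * (coeffMatrix φ * (V k).transpose).conjTranspose := by
    simp only [Matrix.conjTranspose_mul, Matrix.mul_assoc]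
    rw [← Matrix.mul_sum]
    simp only [← Matrix.mul_assoc (V _).transpose]
    rw [← Matrix.sum_mul, hV', Matrix.one_mul]
  simp only [pureHom_eq_right, coeffMatrix_one_kronecker]
  rw [h1]
  exact homEntropy_sum hq hqs _ fun k => Matrix.posSemidef_self_mul_conjTranspose _

/-- The pairs of an unnormalized state and the total entanglement of one of its finite
decompositions into unnormalized pure states. -/
noncomputable def pureCone (q s : ℝ) (A B : Type u) [Fintype A] [DecidableEq A] [Fintype B] :
    AddSubmonoid (Matrix (A × B) (A × B) ℂ × ℝ) :=
  AddSubmonoid.closure (Set.range fun φ : A × B → ℂ => (ketbra φ, pureHom q s φ))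

lemma ketbra_mem_pureCone (φ : A × B → ℂ) : (ketbra φ, pureHom q s φ) ∈ pureCone q s A B :=
  AddSubmonoid.subset_closure ⟨φ, rfl⟩

lemma sum_mem_pureCone {ι : Type*} (t : Finset ι) {ρ : ι → Matrix (A × B) (A × B) ℂ} {x : ι → ℝ}
    (h : ∀ i, (ρ i, x i) ∈ pureCone q s A B) :
    (∑ i ∈ t, ρ i, ∑ i ∈ t, x i) ∈ pureCone q s A B := by
  have := sum_mem (t := t) fun i _ => h i
  have h1 : ∑ i ∈ t, (ρ i, x i) = (∑ i ∈ t, ρ i, ∑ i ∈ t, x i) :=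
    Prod.ext Prod.fst_sum Prod.snd_sum
  rwa [h1] at this

-- Reduces claims about all decompositions to single vectors, provided that they are additive.
@[elab_as_elim]
lemma pureCone_induction
    {motive : ∀ (ρ : Matrix (A × B) (A × B) ℂ) (x : ℝ), (ρ, x) ∈ pureCone q s A B → Prop}
    (pure : ∀ φ, motive (ketbra φ) (pureHom q s φ) (ketbra_mem_pureCone φ))
    (zero : motive 0 0 (zero_mem _))
    (add : ∀ ρ x σ y hx hy, motive ρ x hx → motive σ y hy → motive (ρ + σ) (x + y) (add_mem hx hy))
    {ρ : Matrix (A × B) (A × B) ℂ} {x : ℝ} (h : (ρ, x) ∈ pureCone q s A B) : motive ρ x h := by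
  refine AddSubmonoid.closure_induction (s := Set.range fun φ : A × B → ℂ => (ketbra φ, pureHom q s φ))
    (motive := fun z hz => motive z.1 z.2 hz) ?_ zero ?_ h
  · rintro _ ⟨φ, rfl⟩
    exact pure φ
  · rintro y z _ _ hy hz
    exact add _ _ _ _ _ _ hy hz

lemma smul_mem_pureCone {c : ℝ} (hc : 0 ≤ c) {ρ : Matrix (A × B) (A × B) ℂ} {x : ℝ}
    (h : (ρ, x) ∈ pureCone q s A B) : ((c : ℂ) • ρ, c * x) ∈ pureCone q s A B := by
  induction h using pureCone_induction with
  | pure φ =>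
    rw [← ketbra_sqrt_smul hc, ← pureHom_sqrt_smul hc]
    exact ketbra_mem_pureCone _
  | zero =>
    rw [smul_zero, mul_zero]
    exact zero_mem _
  | add ρ x σ y _ _ h1 h2 =>
    rw [smul_add, mul_add]
    exact add_mem h1 h2

lemma posSemidef_of_mem_pureCone {ρ : Matrix (A × B) (A × B) ℂ} {x : ℝ}
    (h : (ρ, x) ∈ pureCone q s A B) : ρ.PosSemidef := by
  induction h using pureCone_induction with
  | pure φ => exact ketbra_posSemidef φ
  | zero => exact Matrix.PosSemidef.zero
  | add ρ x σ y _ _ h1 h2 => exact h1.add h2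

lemma nonneg_of_mem_pureCone (hq : 1 < q) (hqs : 1 ≤ q * s) {ρ : Matrix (A × B) (A × B) ℂ} {x : ℝ}
    (h : (ρ, x) ∈ pureCone q s A B) : 0 ≤ x := by
  induction h using pureCone_induction with
  | pure φ => exact pureHom_nonneg hq hqs φ
  | zero => exact le_rfl
  | add ρ x σ y _ _ h1 h2 => exact add_nonneg h1 h2

lemma exists_sum_ketbra {X : Type*} [Fintype X] [DecidableEq X] {ρ : Matrix X X ℂ}
    (h : ρ.PosSemidef) : ∃ φ : X → X → ℂ, ρ = ∑ i, ketbra (φ i) := by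
  refine ⟨fun i => ((√(h.isHermitian.eigenvalues i) : ℝ) : ℂ) •
    fun j => (h.isHermitian.eigenvectorUnitary : Matrix X X ℂ) j i, ?_⟩
  conv_lhs => rw [spectral_eq_mul h.isHermitian]
  ext j k
  rw [Matrix.mul_apply, Matrix.sum_apply]
  refine Finset.sum_congr rfl fun i _ => ?_
  rw [Matrix.mul_diagonal, Matrix.star_apply, ketbra_sqrt_smul (h.eigenvalues_nonneg i),
    Matrix.smul_apply, ketbra, Matrix.vecMulVec_apply, Pi.star_apply, smul_eq_mul]
  ring

lemma exists_mem_pureCone (q s : ℝ) {ρ : Matrix (A × B) (A × B) ℂ} (h : ρ.PosSemidef) :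
    ∃ x, (ρ, x) ∈ pureCone q s A B := by
  obtain ⟨φ, hφ⟩ := exists_sum_ketbra h
  exact ⟨∑ i, pureHom q s (φ i), hφ ▸ sum_mem_pureCone _ fun i => ketbra_mem_pureCone (φ i)⟩

end pure

/-! ### LOCC -/

section LOCC

variable {A B A' B' : Type u} [Fintype A] [DecidableEq A] [Fintype B] [DecidableEq B]
  [Fintype A'] [DecidableEq A'] [Fintype B'] [DecidableEq B'] {q s : ℝ}

/-- Measuring each vector of a decomposition gives decompositions of all the outcomes at once; the
bound for a single vector adds up. -/
lemma exists_mem_pureCone_left (hq : 1 < q) (hqs : 1 ≤ q * s) {K : Type*} [Fintype K]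
    {C : K → Type u} [∀ k, Fintype (C k)] [∀ k, DecidableEq (C k)]
    (V : ∀ k, Matrix (C k) A ℂ) (hV : ∑ k, (V k).conjTranspose * V k = 1)
    {ρ : Matrix (A × B) (A × B) ℂ} {x : ℝ} (h : (ρ, x) ∈ pureCone q s A B) :
    ∃ y : K → ℝ, (∀ k, (conjMap (V k ⊗ₖ (1 : Matrix B B ℂ)) ρ, y k) ∈ pureCone q s (C k) B) ∧
      ∑ k, y k ≤ x := by
  induction h using pureCone_induction with
  | pure φ =>
    refine ⟨fun k => pureHom q s ((V k ⊗ₖ (1 : Matrix B B ℂ)).mulVec φ), fun k => ?_,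
      sum_pureHom_left_le hq hqs V hV φ⟩
    rw [conjMap_ketbra]
    exact ketbra_mem_pureCone _
  | zero =>
    refine ⟨fun _ => 0, fun k => ?_, by simp⟩
    rw [map_zero]
    exact zero_mem _
  | add ρ x σ z _ _ h1 h2 =>
    obtain ⟨y, hy, hyx⟩ := h1
    obtain ⟨w, hw, hwz⟩ := h2
    refine ⟨fun k => y k + w k, fun k => ?_, ?_⟩
    · rw [map_add]
      exact add_mem (hy k) (hw k)
    · rw [Finset.sum_add_distrib]
      exact add_le_add hyx hwz

lemma exists_mem_pureCone_right (hq : 1 < q) (hqs : 1 ≤ q * s) {K : Type*} [Fintype K]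
    {D : K → Type u} [∀ k, Fintype (D k)] [∀ k, DecidableEq (D k)]
    (V : ∀ k, Matrix (D k) B ℂ) (hV : ∑ k, (V k).conjTranspose * V k = 1)
    {ρ : Matrix (A × B) (A × B) ℂ} {x : ℝ} (h : (ρ, x) ∈ pureCone q s A B) :
    ∃ y : K → ℝ, (∀ k, (conjMap ((1 : Matrix A A ℂ) ⊗ₖ V k) ρ, y k) ∈ pureCone q s A (D k)) ∧
      ∑ k, y k ≤ x := by
  induction h using pureCone_induction with
  | pure φ =>
    refine ⟨fun k => pureHom q s (((1 : Matrix A A ℂ) ⊗ₖ V k).mulVec φ), fun k => ?_,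
      sum_pureHom_right_le hq hqs V hV φ⟩
    rw [conjMap_ketbra]
    exact ketbra_mem_pureCone _
  | zero =>
    refine ⟨fun _ => 0, fun k => ?_, by simp⟩
    rw [map_zero]
    exact zero_mem _
  | add ρ x σ z _ _ h1 h2 =>
    obtain ⟨y, hy, hyx⟩ := h1
    obtain ⟨w, hw, hwz⟩ := h2
    refine ⟨fun k => y k + w k, fun k => ?_, ?_⟩
    · rw [map_add]
      exact add_mem (hy k) (hw k)
    · rw [Finset.sum_add_distrib]
      exact add_le_add hyx hwz

/-- An LOCC instrument does not increase the total entanglement of decompositions. -/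
lemma IsLOCC.exists_mem_pureCone (hq : 1 < q) (hqs : 1 ≤ q * s) {J : Type} [Fintype J]
    {𝓔 : J → (Matrix (A × B) (A × B) ℂ →ₗ[ℂ] Matrix (A' × B') (A' × B') ℂ)} (h𝓔 : IsLOCC 𝓔)
    (ρ : Matrix (A × B) (A × B) ℂ) (x : ℝ) (h : (ρ, x) ∈ pureCone q s A B) :
    ∃ y : J → ℝ, (∀ j, (𝓔 j ρ, y j) ∈ pureCone q s A' B') ∧ ∑ j, y j ≤ x := by
  induction h𝓔 generalizing x with
  | nothing => exact ⟨fun _ => x, fun _ => h, by simp⟩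
  | alice V hV 𝓔 _ ih =>
    obtain ⟨y, hy, hyx⟩ := exists_mem_pureCone_left hq hqs V hV h
    choose z hz hzy using fun k => ih k _ _ (hy k)
    refine ⟨fun w => z w.1 w.2, fun w => hz w.1 w.2, ?_⟩
    rw [Fintype.sum_sigma]
    exact (Finset.sum_le_sum fun k _ => hzy k).trans hyx
  | bob V hV 𝓔 _ ih =>
    obtain ⟨y, hy, hyx⟩ := exists_mem_pureCone_right hq hqs V hV h
    choose z hz hzy using fun k => ih k _ _ (hy k)
    refine ⟨fun w => z w.1 w.2, fun w => hz w.1 w.2, ?_⟩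
    rw [Fintype.sum_sigma]
    exact (Finset.sum_le_sum fun k _ => hzy k).trans hyx
  | forget f 𝓔 _ ih =>
    obtain ⟨y, hy, hyx⟩ := ih ρ x h
    refine ⟨fun j' => ∑ j with f j = j', y j, fun j' => ?_, ?_⟩
    · rw [LinearMap.sum_apply]
      exact sum_mem_pureCone _ hy
    · rwa [Finset.sum_fiberwise]

lemma sum_kronecker {K X Y : Type*} (t : Finset K) (M : K → Matrix X X ℂ) (N : Matrix Y Y ℂ) :
    (∑ k ∈ t, M k) ⊗ₖ N = ∑ k ∈ t, M k ⊗ₖ N := by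
  ext x y
  simp [Matrix.sum_apply, Matrix.kroneckerMap_apply, Finset.sum_mul]

lemma kronecker_sum {K X Y : Type*} (t : Finset K) (M : Matrix X X ℂ) (N : K → Matrix Y Y ℂ) :
    M ⊗ₖ (∑ k ∈ t, N k) = ∑ k ∈ t, M ⊗ₖ N k := by
  ext x y
  simp [Matrix.sum_apply, Matrix.kroneckerMap_apply, Finset.mul_sum]

lemma trace_conjMap {X Y : Type u} [Fintype X] [Fintype Y] (V : Matrix Y X ℂ) (ρ : Matrix X X ℂ) :
    (conjMap V ρ).trace = (V.conjTranspose * V * ρ).trace := by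
  change (V * ρ * V.conjTranspose).trace = _
  rw [Matrix.trace_mul_comm, Matrix.mul_assoc]

/-- LOCC instruments preserve the total trace. -/
lemma IsLOCC.sum_trace {J : Type} [Fintype J]
    {𝓔 : J → (Matrix (A × B) (A × B) ℂ →ₗ[ℂ] Matrix (A' × B') (A' × B') ℂ)} (h𝓔 : IsLOCC 𝓔)
    (ρ : Matrix (A × B) (A × B) ℂ) : ∑ j, (𝓔 j ρ).trace = ρ.trace := by
  induction h𝓔 with
  | nothing => simp
  | alice V hV 𝓔 _ ih =>
    rw [Fintype.sum_sigma]
    simp only [LinearMap.comp_apply, ih, trace_conjMap]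
    rw [← Matrix.trace_sum, ← Matrix.sum_mul]
    simp only [Matrix.conjTranspose_kronecker, Matrix.conjTranspose_one,
      ← Matrix.mul_kronecker_mul, mul_one]
    rw [← sum_kronecker, hV, Matrix.one_kronecker_one, one_mul]
  | bob V hV 𝓔 _ ih =>
    rw [Fintype.sum_sigma]
    simp only [LinearMap.comp_apply, ih, trace_conjMap]
    rw [← Matrix.trace_sum, ← Matrix.sum_mul]
    simp only [Matrix.conjTranspose_kronecker, Matrix.conjTranspose_one,
      ← Matrix.mul_kronecker_mul, mul_one]
    rw [← kronecker_sum, hV, Matrix.one_kronecker_one, one_mul]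
  | forget f 𝓔 _ ih =>
    simp only [LinearMap.sum_apply, Matrix.trace_sum]
    rw [Finset.sum_fiberwise, ih]

end LOCC

/-! ### Compactness of convex hulls in finite dimension -/

/-- By Carathéodory, boundedly many points suffice, so the hull is a finite union of continuous
images of simplices times powers of `S`. -/
lemma isCompact_convexHull_of_finiteDimensional {E : Type*} [AddCommGroup E] [Module ℝ E]
    [TopologicalSpace E] [IsTopologicalAddGroup E] [ContinuousSMul ℝ E] [FiniteDimensional ℝ E]
    {S : Set E} (hS : IsCompact S) : IsCompact (convexHull ℝ S) := by
  set d := Module.finrank ℝ E with hd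
  -- An affinely independent family has at most `d + 1` members, so `n` ranges over values below `d
  -- + 2`.
  have key : convexHull ℝ S = ⋃ n ∈ Finset.range (d + 2),
      (fun p : (Fin n → ℝ) × (Fin n → E) => ∑ i, p.1 i • p.2 i) ''
        (stdSimplex ℝ (Fin n) ×ˢ Set.univ.pi fun _ => S) := by
    apply Set.Subset.antisymm
    · intro x hx
      obtain ⟨ι, _, z, w, hz, hind, hw, hw1, hx⟩ := eq_pos_convex_span_of_mem_convexHull hx
      have hcard : Fintype.card ι ≤ d + 1 :=
        hind.card_le_finrank_succ.trans (Nat.succ_le_succ (Submodule.finrank_le _))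
      simp only [Set.mem_iUnion]
      let e := Fintype.equivFin ι
      refine ⟨Fintype.card ι, Finset.mem_range.2 (by omega),
        (fun i => w (e.symm i), fun i => z (e.symm i)), ⟨⟨fun i => (hw _).le, ?_⟩, ?_⟩, ?_⟩
      · rw [← hw1]
        exact e.symm.sum_comp w
      · exact fun i _ => hz ⟨_, rfl⟩
      · rw [← hx]
        exact e.symm.sum_comp fun i => w i • z i
    · simp only [Set.iUnion_subset_iff]
      rintro n _ _ ⟨⟨w, z⟩, ⟨⟨hw, hw1⟩, hz⟩, rfl⟩
      exact (convex_convexHull ℝ S).sum_mem (fun i _ => hw i) hw1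
        fun i _ => subset_convexHull ℝ S (hz i (Set.mem_univ i))
  rw [key]
  refine Finset.isCompact_biUnion _ fun n _ => ?_
  refine ((isCompact_stdSimplex ℝ (Fin n)).prod (isCompact_univ_pi fun _ => hS)).image ?_
  fun_prop

/-! ### The convex roof as the lower boundary of a compact convex hull -/

section roof

variable {A B : Type u} [Fintype A] [DecidableEq A] [Fintype B] [DecidableEq B] {q s : ℝ}

/-- The graph of the entanglement on normalized pure states. -/
def pureGraph (q s : ℝ) (A B : Type u) [Fintype A] [DecidableEq A] [Fintype B] :
    Set (Matrix (A × B) (A × B) ℂ × ℝ) :=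
  (fun ψ : A × B → ℂ => (ketbra ψ, pureUnifiedEntanglement q s ψ)) '' {ψ | IsUnitVector ψ}

lemma isUnitVector_iff {X : Type u} [Fintype X] (ψ : X → ℂ) :
    IsUnitVector ψ ↔ ∑ i, Complex.normSq (ψ i) = 1 := by
  rw [IsUnitVector, ← Complex.ofReal_inj]
  simp [dotProduct, Complex.normSq_eq_conj_mul_self]

lemma isCompact_unitVectors {X : Type u} [Fintype X] :
    IsCompact {ψ : X → ℂ | IsUnitVector ψ} := by
  have h1 : {ψ : X → ℂ | IsUnitVector ψ} ⊆ Set.univ.pi fun _ => Metric.closedBall (0 : ℂ) 1 := by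
    intro ψ hψ i _
    have h2 : Complex.normSq (ψ i) ≤ 1 := by
      rw [← (isUnitVector_iff ψ).1 hψ]
      exact Finset.single_le_sum (fun j _ => Complex.normSq_nonneg (ψ j)) (Finset.mem_univ i)
    rw [Complex.normSq_eq_norm_sq] at h2
    rw [mem_closedBall_zero_iff]
    exact (sq_le_one_iff₀ (norm_nonneg _)).1 h2
  refine (isCompact_univ_pi fun _ => isCompact_closedBall (0 : ℂ) 1).of_isClosed_subset ?_ h1
  have : {ψ : X → ℂ | IsUnitVector ψ} = {ψ | ∑ i, Complex.normSq (ψ i) = 1} := by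
    ext ψ
    exact isUnitVector_iff ψ
  rw [this]
  exact isClosed_eq (by fun_prop) continuous_const

lemma continuous_ketbra {X : Type*} : Continuous (ketbra : (X → ℂ) → Matrix X X ℂ) :=
  continuous_id.matrix_vecMulVec continuous_id.star

lemma continuous_traceRight {A B : Type u} [Fintype B] :
    Continuous (traceRight : Matrix (A × B) (A × B) ℂ → Matrix A A ℂ) := by
  refine continuous_matrix fun a a' => ?_
  exact continuous_finsetSum _ fun b _ => continuous_id.matrix_elem _ _

lemma continuousOn_pureUnifiedEntanglement (hq : 1 < q) (hqs : 1 ≤ q * s) :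
    ContinuousOn (pureUnifiedEntanglement q s (A := A) (B := B)) {ψ | IsUnitVector ψ} :=
  (continuousOn_unifiedEntropy hq hqs).comp
    (continuous_traceRight.comp continuous_ketbra).continuousOn fun _ hψ =>
      IsUnitVector.isState_traceRight hψ

lemma isCompact_pureGraph (hq : 1 < q) (hqs : 1 ≤ q * s) : IsCompact (pureGraph q s A B) :=
  isCompact_unitVectors.image_of_continuousOn
    (continuous_ketbra.continuousOn.prodMk (continuousOn_pureUnifiedEntanglement hq hqs))

lemma convex_states {X : Type u} [Fintype X] : Convex ℝ {ρ : Matrix X X ℂ | IsState ρ} := by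
  intro ρ hρ σ hσ a b ha hb hab
  refine ⟨?_, ?_⟩
  · exact (hρ.1.smul ha).add (hσ.1.smul hb)
  · rw [Matrix.trace_add, Matrix.trace_smul, Matrix.trace_smul, hρ.2, hσ.2]
    rw [← add_smul, hab, one_smul]

lemma real_smul_matrix {X Y : Type*} (c : ℝ) (ρ : Matrix X Y ℂ) : c • ρ = (c : ℂ) • ρ := by
  ext i j
  simp

lemma isState_of_mem_convexHull {z : Matrix (A × B) (A × B) ℂ × ℝ}
    (h : z ∈ convexHull ℝ (pureGraph q s A B)) : IsState z.1 := by
  have : convexHull ℝ (pureGraph q s A B) ⊆ (LinearMap.fst ℝ _ ℝ) ⁻¹' {ρ | IsState ρ} := by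
    refine convexHull_min ?_ (convex_states.linear_preimage _)
    rintro _ ⟨ψ, hψ, rfl⟩
    exact IsUnitVector.isState_ketbra hψ
  exact this h

lemma convexHull_subset_pureCone {z : Matrix (A × B) (A × B) ℂ × ℝ}
    (h : z ∈ convexHull ℝ (pureGraph q s A B)) : z ∈ pureCone q s A B := by
  have h1 : Convex ℝ (pureCone q s A B : Set (Matrix (A × B) (A × B) ℂ × ℝ)) := by
    rintro ⟨ρ, x⟩ hx ⟨σ, y⟩ hy a b ha hb -
    have := add_mem (smul_mem_pureCone ha hx) (smul_mem_pureCone hb hy)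
    rw [← real_smul_matrix, ← real_smul_matrix] at this
    exact this
  refine convexHull_min ?_ h1 h
  rintro _ ⟨ψ, hψ, rfl⟩
  change (ketbra ψ, pureUnifiedEntanglement q s ψ) ∈ pureCone q s A B
  rw [← IsUnitVector.pureHom_eq hψ]
  exact ketbra_mem_pureCone ψ

/-- Homogeneity lets each nonzero generator be normalised to a point of the graph, and sums are
renormalised to convex combinations. -/
lemma exists_eq_smul_of_mem_pureCone [Nonempty (A × B)] {ρ : Matrix (A × B) (A × B) ℂ} {x : ℝ}
    (h : (ρ, x) ∈ pureCone q s A B) :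
    ∃ c : ℝ, 0 ≤ c ∧ ∃ z ∈ convexHull ℝ (pureGraph q s A B), (ρ, x) = c • z := by
  -- A base point of the hull, to be taken with coefficient zero for vanishing elements.
  obtain ⟨z₀, hz₀⟩ : (pureGraph q s A B).Nonempty := by
    refine ⟨_, Pi.single (Classical.arbitrary _) 1, ?_, rfl⟩
    simp [IsUnitVector]
  induction h using pureCone_induction with
  | pure φ =>
    have htr := PosSemidef.trace_re_nonneg (ketbra_posSemidef φ)
    by_cases h0 : ketbra φ = 0
    · refine ⟨0, le_rfl, z₀, subset_convexHull ℝ _ hz₀, ?_⟩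
      have : traceRight (0 : Matrix (A × B) (A × B) ℂ) = 0 := by
        ext
        simp [traceRight]
      rw [zero_smul, pureHom, h0, this, homEntropy_zero]
      rfl
    · have h1 := PosSemidef.isState_normalize (ketbra_posSemidef φ) h0
      rw [← ketbra_sqrt_smul (inv_nonneg.2 htr)] at h1
      have h2 : IsUnitVector (((√((ketbra φ).trace.re⁻¹) : ℝ) : ℂ) • φ) := by
        rw [IsUnitVector, ← trace_ketbra]
        exact h1.2
      refine ⟨(ketbra φ).trace.re, htr, _, subset_convexHull ℝ _ ⟨_, h2, rfl⟩, ?_⟩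
      have h3 : (ketbra φ).trace.re ≠ 0 := fun h =>
        h0 (PosSemidef.eq_zero_of_trace_re (ketbra_posSemidef φ) h)
      beta_reduce
      rw [← IsUnitVector.pureHom_eq h2, pureHom_sqrt_smul (inv_nonneg.2 htr),
        ketbra_sqrt_smul (inv_nonneg.2 htr)]
      refine Prod.ext ?_ ?_
      · change _ = (ketbra φ).trace.re • _
        rw [real_smul_matrix, smul_smul, ← Complex.ofReal_mul, mul_inv_cancel₀ h3,
          Complex.ofReal_one, one_smul]
      · change _ = (ketbra φ).trace.re * _
        rw [← mul_assoc, mul_inv_cancel₀ h3, one_mul]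
  | zero => exact ⟨0, le_rfl, z₀, subset_convexHull ℝ _ hz₀, by rw [zero_smul]; rfl⟩
  | add ρ x σ y _ _ h1 h2 =>
    obtain ⟨a, ha, z, hz, h1⟩ := h1
    obtain ⟨b, hb, w, hw, h2⟩ := h2
    have h3 : (ρ + σ, x + y) = a • z + b • w := by
      rw [← h1, ← h2]
      rfl
    by_cases hab : a + b = 0
    · have ha0 : a = 0 := by linarith
      have hb0 : b = 0 := by linarith
      exact ⟨0, le_rfl, z, hz, by simp [h3, ha0, hb0]⟩
    · have hab' : 0 < a + b := lt_of_le_of_ne (by positivity) (Ne.symm hab)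
      refine ⟨a + b, hab'.le, (a / (a + b)) • z + (b / (a + b)) • w,
        convex_convexHull ℝ _ hz hw (by positivity) (by positivity)
          (by rw [← add_div, div_self hab]), ?_⟩
      rw [h3, smul_add, smul_smul, smul_smul, mul_div_cancel₀ _ hab, mul_div_cancel₀ _ hab]

lemma IsState.nonempty {X : Type u} [Fintype X] {ρ : Matrix X X ℂ} (h : IsState ρ) :
    Nonempty X := by
  by_contra hX
  rw [not_nonempty_iff] at hX
  exact h.ne_zero (Subsingleton.elim _ _)

/-- Comparing traces forces the scaling factor between the cone and the hull to be one. -/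
lemma IsState.mem_pureCone_iff {ρ : Matrix (A × B) (A × B) ℂ} (hρ : IsState ρ) {x : ℝ} :
    (ρ, x) ∈ pureCone q s A B ↔ (ρ, x) ∈ convexHull ℝ (pureGraph q s A B) := by
  refine ⟨fun h => ?_, convexHull_subset_pureCone⟩
  have := hρ.nonempty
  obtain ⟨c, -, z, hz, h1⟩ := exists_eq_smul_of_mem_pureCone h
  have h2 : ρ = c • z.1 := congrArg Prod.fst h1
  have h3 := congrArg Matrix.trace h2
  rw [hρ.2, Matrix.trace_smul, (isState_of_mem_convexHull hz).2] at h3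
  have hc : c = 1 := by
    have := congrArg Complex.re h3
    simpa using this.symm
  rw [h1, hc, one_smul]
  exact hz

lemma mem_ensembleAverages_iff {ρ : Matrix (A × B) (A × B) ℂ} {x : ℝ} :
    x ∈ ensembleAverages (pureUnifiedEntanglement q s (A := A) (B := B)) ρ ↔
      (ρ, x) ∈ convexHull ℝ (pureGraph q s A B) := by
  constructor
  · rintro ⟨n, p, ψ, ⟨hp, hp1, hψ, rfl⟩, rfl⟩
    refine mem_convexHull_of_exists_fintype p
      (fun j => (ketbra (ψ j), pureUnifiedEntanglement q s (ψ j))) hp hp1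
      (fun j => ⟨ψ j, hψ j, rfl⟩) (Prod.ext ?_ ?_)
    · rw [Prod.fst_sum]
      exact Finset.sum_congr rfl fun j _ => real_smul_matrix _ _
    · rw [Prod.snd_sum]
      rfl
  · intro h
    obtain ⟨ι, _, w, z, hw, hw1, hz, h⟩ := mem_convexHull_iff_exists_fintype.1 h
    choose ψ hψ hψz using hz
    let e := Fintype.equivFin ι
    refine ⟨Fintype.card ι, fun i => w (e.symm i), fun i => ψ (e.symm i),
      ⟨fun i => hw _, ?_, fun i => hψ _, ?_⟩, ?_⟩
    · rw [← hw1]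
      exact e.symm.sum_comp w
    · have h1 := congrArg Prod.fst h
      rw [Prod.fst_sum] at h1
      change _ = ρ at h1
      rw [← h1, e.symm.sum_comp fun i => (w i : ℂ) • ketbra (ψ i)]
      refine Finset.sum_congr rfl fun i _ => ?_
      rw [← hψz, ← real_smul_matrix]
      rfl
    · have h1 := congrArg Prod.snd h
      rw [Prod.snd_sum] at h1
      change _ = x at h1
      rw [← h1, e.symm.sum_comp fun i => w i * pureUnifiedEntanglement q s (ψ i)]
      refine Finset.sum_congr rfl fun i _ => ?_
      rw [← hψz]
      rfl

/-- The minimum in the convex roof is attained. -/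
lemma IsState.isLeast (hq : 1 < q) (hqs : 1 ≤ q * s) {ρ : Matrix (A × B) (A × B) ℂ}
    (hρ : IsState ρ) :
    IsLeast (ensembleAverages (pureUnifiedEntanglement q s (A := A) (B := B)) ρ)
      (unifiedEntanglement q s A B ρ) := by
  have hset : ensembleAverages (pureUnifiedEntanglement q s (A := A) (B := B)) ρ =
      Prod.snd '' (convexHull ℝ (pureGraph q s A B) ∩ {z | z.1 = ρ}) := by
    ext x
    rw [mem_ensembleAverages_iff]
    constructor
    · exact fun h => ⟨_, ⟨h, rfl⟩, rfl⟩
    · rintro ⟨⟨σ, y⟩, ⟨h, rfl : σ = ρ⟩, rfl⟩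
      exact h
  refine IsCompact.isLeast_sInf ?_ ?_
  · rw [hset]
    exact (((isCompact_convexHull_of_finiteDimensional (isCompact_pureGraph hq hqs)).inter_right
      (isClosed_eq continuous_fst continuous_const)).image continuous_snd)
  · obtain ⟨x, hx⟩ := exists_mem_pureCone q s hρ.1
    exact ⟨x, mem_ensembleAverages_iff.2 (hρ.mem_pureCone_iff.1 hx)⟩

lemma IsState.unifiedEntanglement_mem (hq : 1 < q) (hqs : 1 ≤ q * s)
    {ρ : Matrix (A × B) (A × B) ℂ} (hρ : IsState ρ) :
    (ρ, unifiedEntanglement q s A B ρ) ∈ pureCone q s A B :=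
  hρ.mem_pureCone_iff.2 (mem_ensembleAverages_iff.1 (hρ.isLeast hq hqs).1)

lemma IsState.unifiedEntanglement_le (hq : 1 < q) (hqs : 1 ≤ q * s)
    {ρ : Matrix (A × B) (A × B) ℂ} (hρ : IsState ρ) {x : ℝ} (h : (ρ, x) ∈ pureCone q s A B) :
    unifiedEntanglement q s A B ρ ≤ x :=
  (hρ.isLeast hq hqs).2 (mem_ensembleAverages_iff.2 (hρ.mem_pureCone_iff.1 h))

end roof

/-! ### Monotonicity -/

section monotone

variable {A B C : Type u} [Fintype A] [DecidableEq A] [Fintype B] [DecidableEq B]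
  [Fintype C] [DecidableEq C] {q s : ℝ}

/-- Spectral decompositions of both factors give a decomposition into product vectors, whose
reductions have rank at most one and hence zero entropy. -/
lemma kronecker_mem_pureCone (hq : q ≠ 0) {α : Matrix A A ℂ} {β : Matrix B B ℂ}
    (hα : α.PosSemidef) (hβ : β.PosSemidef) : (α ⊗ₖ β, (0 : ℝ)) ∈ pureCone q s A B := by
  have hprod : ∀ (a : A → ℂ) (b : B → ℂ), (ketbra a ⊗ₖ ketbra b, (0 : ℝ)) ∈ pureCone q s A B := by
    intro a b
    have h1 : ketbra a ⊗ₖ ketbra b = ketbra fun x : A × B => a x.1 * b x.2 := by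
      ext x y
      simp [ketbra, Matrix.vecMulVec_apply, Matrix.kroneckerMap_apply]
      ring
    have h2 : traceRight (ketbra fun x : A × B => a x.1 * b x.2) =
        (((ketbra b).trace.re : ℝ) : ℂ) • ketbra a := by
      rw [PosSemidef.coe_trace_re (ketbra_posSemidef b)]
      ext x y
      simp [traceRight, ketbra, Matrix.vecMulVec_apply, Matrix.trace, Finset.sum_mul]
      refine Finset.sum_congr rfl fun i _ => ?_
      ring
    have h3 : pureHom q s (fun x : A × B => a x.1 * b x.2) = 0 := by
      rw [pureHom, h2, homEntropy_smul, homEntropy_ketbra hq, mul_zero]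
    rw [h1, ← h3]
    exact ketbra_mem_pureCone _
  obtain ⟨a, rfl⟩ := exists_sum_ketbra hα
  obtain ⟨b, rfl⟩ := exists_sum_ketbra hβ
  rw [sum_kronecker]
  simp only [kronecker_sum]
  have := sum_mem_pureCone (q := q) (s := s) (A := A) (B := B) Finset.univ fun i =>
    sum_mem_pureCone Finset.univ fun j => hprod (a i) (b j)
  simpa using this

lemma IsSeparable.mem_pureCone (hq : q ≠ 0) {ρ : Matrix (A × B) (A × B) ℂ} (h : IsSeparable ρ) :
    (ρ, (0 : ℝ)) ∈ pureCone q s A B := by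
  obtain ⟨n, p, α, β, hp, -, hα, hβ, rfl⟩ := h
  have := sum_mem_pureCone (q := q) (s := s) Finset.univ fun j =>
    smul_mem_pureCone (hp j) (kronecker_mem_pureCone hq (hα j).1 (hβ j).1)
  simpa using this

lemma IsSeparable.isState {ρ : Matrix (A × B) (A × B) ℂ} (h : IsSeparable ρ) : IsState ρ := by
  -- Positivity does not depend on the parameters; any `q ≠ 0` would serve here.
  refine ⟨posSemidef_of_mem_pureCone (h.mem_pureCone (q := 1) (s := 1) one_ne_zero), ?_⟩
  obtain ⟨n, p, α, β, hp, hp1, hα, hβ, rfl⟩ := h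
  rw [Matrix.trace_sum]
  simp only [Matrix.trace_smul, Matrix.trace_kronecker, (hα _).2, (hβ _).2, mul_one, smul_eq_mul]
  exact_mod_cast hp1

lemma IsState.unifiedEntanglement_nonneg (hq : 1 < q) (hqs : 1 ≤ q * s)
    {ρ : Matrix (A × B) (A × B) ℂ} (hρ : IsState ρ) : 0 ≤ unifiedEntanglement q s A B ρ :=
  nonneg_of_mem_pureCone hq hqs (hρ.unifiedEntanglement_mem hq hqs)

lemma IsState.unifiedEntanglement_eq_zero (hq : 1 < q) (hqs : 1 ≤ q * s)
    {ρ : Matrix (A × B) (A × B) ℂ} (hρ : IsState ρ) (h : (ρ, (0 : ℝ)) ∈ pureCone q s A B) :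
    unifiedEntanglement q s A B ρ = 0 :=
  le_antisymm (hρ.unifiedEntanglement_le hq hqs h) (hρ.unifiedEntanglement_nonneg hq hqs)

lemma unifiedEntanglement_average (hq : 1 < q) (hqs : 1 ≤ q * s) {A' B' : Type u} [Fintype A']
    [DecidableEq A'] [Fintype B'] [DecidableEq B'] {J : Type} [Fintype J]
    {𝓔 : J → (Matrix (A × B) (A × B) ℂ →ₗ[ℂ] Matrix (A' × B') (A' × B') ℂ)} (h𝓔 : IsLOCC 𝓔)
    {ρ : Matrix (A × B) (A × B) ℂ} {p : J → ℝ} {σ : J → Matrix (A' × B') (A' × B') ℂ}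
    (hρ : IsState ρ) (hp : ∀ j, 0 ≤ p j) (hσ : ∀ j, IsState (σ j))
    (h : ∀ j, 𝓔 j ρ = (p j : ℂ) • σ j) :
    ∑ j, p j * unifiedEntanglement q s A' B' (σ j) ≤ unifiedEntanglement q s A B ρ := by
  obtain ⟨y, hy, hyE⟩ := h𝓔.exists_mem_pureCone hq hqs ρ _ (hρ.unifiedEntanglement_mem hq hqs)
  refine (Finset.sum_le_sum fun j _ => ?_).trans hyE
  -- An outcome of positive probability is renormalised by `(p j)⁻¹`; one of probability zero only
  -- needs `y j ≥ 0`.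
  have h1 := hy j
  by_cases hpj : p j = 0
  · rw [hpj, zero_mul]
    exact nonneg_of_mem_pureCone hq hqs h1
  · have hpj' : 0 < p j := lt_of_le_of_ne (hp j) (Ne.symm hpj)
    rw [h j] at h1
    have h2 := smul_mem_pureCone (inv_nonneg.2 (hp j)) h1
    rw [smul_smul, ← Complex.ofReal_mul, inv_mul_cancel₀ hpj, Complex.ofReal_one, one_smul] at h2
    have h3 := (hσ j).unifiedEntanglement_le hq hqs h2
    rwa [le_inv_mul_iff₀ hpj'] at h3

lemma isEntanglementMonotone_unifiedEntanglement (hq : 1 < q) (hqs : 1 ≤ q * s) :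
    IsEntanglementMonotone (unifiedEntanglement.{u} q s) where
  nonneg A B _ _ _ _ ρ hρ := hρ.unifiedEntanglement_nonneg hq hqs
  separable A B _ _ _ _ ρ hρ :=
    hρ.isState.unifiedEntanglement_eq_zero hq hqs (hρ.mem_pureCone (by positivity))
  locc A B A' B' _ _ _ _ _ _ _ _ Φ hΦ ρ hρ := by
    have hΦ' : IsLOCC fun _ : Unit => Φ := hΦ
    have h1 : IsState (Φ ρ) := by
      obtain ⟨y, hy, -⟩ := hΦ'.exists_mem_pureCone hq hqs ρ _ (hρ.unifiedEntanglement_mem hq hqs)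
      refine ⟨posSemidef_of_mem_pureCone (hy ()), ?_⟩
      have := hΦ'.sum_trace ρ
      rw [hρ.2] at this
      simpa using this
    have := unifiedEntanglement_average hq hqs hΦ' (p := fun _ => 1) (σ := fun _ => Φ ρ) hρ
      (fun _ => zero_le_one) (fun _ => h1) (fun _ => by simp)
    simpa using this
  convex A B _ _ _ _ := by
    refine ⟨convex_states, fun ρ hρ σ hσ a b ha hb hab => ?_⟩
    have h1 : IsState (a • ρ + b • σ) := convex_states hρ hσ ha hb hab
    refine h1.unifiedEntanglement_le hq hqs ?_
    rw [real_smul_matrix, real_smul_matrix]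
    exact add_mem (smul_mem_pureCone ha (hρ.unifiedEntanglement_mem hq hqs))
      (smul_mem_pureCone hb (hσ.unifiedEntanglement_mem hq hqs))
  average A B A' B' _ _ _ _ _ _ _ _ J _ 𝓔 h𝓔 ρ p σ hρ hp hσ h :=
    unifiedEntanglement_average hq hqs h𝓔 hρ hp hσ h

end monotone

/-! ### Monogamy -/

section monogamy

variable {A B C : Type u} [Fintype A] [DecidableEq A] [Fintype B] [DecidableEq B]
  [Fintype C] [DecidableEq C] {q s : ℝ}

/-- The coefficients of a tripartite vector, as a matrix from `C` to `AB`. -/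
def coeffMatrixAB {A B C : Type*} (φ : A × (B × C) → ℂ) : Matrix (A × B) C ℂ :=
  Matrix.of fun x c => φ (x.1, (x.2, c))

/-- The partial inner product of a tripartite vector with a vector of the third system. -/
def partialInner {A B C : Type u} [Fintype C] (v : C → ℂ) (φ : A × (B × C) → ℂ) : A × B → ℂ :=
  (coeffMatrixAB φ).mulVec (star v)

lemma reduceAB_ketbra (φ : A × (B × C) → ℂ) :
    reduceAB (ketbra φ) = coeffMatrixAB φ * (coeffMatrixAB φ).conjTranspose := by
  ext x y
  simp [reduceAB, ketbra, coeffMatrixAB, Matrix.mul_apply, Matrix.vecMulVec_apply]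

lemma traceRight_reduceAB {A B C : Type u} [Fintype B] [Fintype C]
    (ρ : Matrix (A × (B × C)) (A × (B × C)) ℂ) : traceRight (reduceAB ρ) = traceRight ρ := by
  ext a a'
  simp [traceRight, reduceAB, Fintype.sum_prod_type]

lemma traceRight_add {A B : Type u} [Fintype B] (ρ σ : Matrix (A × B) (A × B) ℂ) :
    traceRight (ρ + σ) = traceRight ρ + traceRight σ := by
  ext
  simp [traceRight, Finset.sum_add_distrib]

lemma traceRight_zero {A B : Type u} [Fintype B] :
    traceRight (0 : Matrix (A × B) (A × B) ℂ) = 0 := by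
  ext
  simp [traceRight]

lemma traceRight_sum {A B : Type u} [Fintype B] {K : Type*} (t : Finset K)
    (ρ : K → Matrix (A × B) (A × B) ℂ) : traceRight (∑ k ∈ t, ρ k) = ∑ k ∈ t, traceRight (ρ k) := by
  ext a a'
  simp only [traceRight, Matrix.of_apply, Matrix.sum_apply]
  exact Finset.sum_comm

/-- Superadditivity bounds every decomposition by the entropy of the reduction to `A`, with equality
for a single vector. -/
lemma le_homEntropy_of_mem_pureCone (hq : 1 < q) (hqs : 1 ≤ q * s)
    {ρ : Matrix (A × B) (A × B) ℂ} {x : ℝ} (h : (ρ, x) ∈ pureCone q s A B) :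
    (traceRight ρ).PosSemidef ∧ x ≤ homEntropy q s (traceRight ρ) := by
  induction h using pureCone_induction with
  | pure φ => exact ⟨traceRight_ketbra_posSemidef φ, le_rfl⟩
  | zero =>
    rw [traceRight_zero, homEntropy_zero]
    exact ⟨Matrix.PosSemidef.zero, le_rfl⟩
  | add ρ x σ y _ _ h1 h2 =>
    rw [traceRight_add]
    have := (homEntropy_add hq hqs h1.1 h2.1).1
    exact ⟨h1.1.add h2.1, by linarith [h1.2, h2.2]⟩

lemma reduceAB_add {A B C : Type u} [Fintype C] (ρ σ : Matrix (A × (B × C)) (A × (B × C)) ℂ) :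
    reduceAB (ρ + σ) = reduceAB ρ + reduceAB σ := by
  ext
  simp [reduceAB, Finset.sum_add_distrib]

/-- Tracing out part of the second party does not increase the entanglement. -/
lemma exists_reduceAB_mem_pureCone (hq : 1 < q) (hqs : 1 ≤ q * s)
    {ρ : Matrix (A × (B × C)) (A × (B × C)) ℂ} {x : ℝ} (h : (ρ, x) ∈ pureCone q s A (B × C)) :
    ∃ y ≤ x, (reduceAB ρ, y) ∈ pureCone q s A B := by
  induction h using pureCone_induction with
  | pure φ =>
    have h1 : reduceAB (ketbra φ) = ∑ c, ketbra fun x : A × B => φ (x.1, (x.2, c)) := by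
      ext x y
      simp [reduceAB, ketbra, Matrix.sum_apply, Matrix.vecMulVec_apply]
    refine ⟨∑ c, pureHom q s fun x : A × B => φ (x.1, (x.2, c)), ?_, ?_⟩
    · refine (homEntropy_sum hq hqs _ fun c => traceRight_ketbra_posSemidef _).trans_eq ?_
      rw [← traceRight_sum, ← h1, traceRight_reduceAB, pureHom]
    · rw [h1]
      exact sum_mem_pureCone _ fun c => ketbra_mem_pureCone _
  | zero =>
    have : reduceAB (0 : Matrix (A × (B × C)) (A × (B × C)) ℂ) = 0 := by
      ext
      simp [reduceAB]
    exact ⟨0, le_rfl, by rw [this]; exact zero_mem _⟩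
  | add ρ x σ y _ _ h1 h2 =>
    obtain ⟨x', hx', hρ⟩ := h1
    obtain ⟨y', hy', hσ⟩ := h2
    exact ⟨x' + y', add_le_add hx' hy', by rw [reduceAB_add]; exact add_mem hρ hσ⟩

lemma one_sub_ketbra_posSemidef {X : Type u} [Fintype X] [DecidableEq X] {v : X → ℂ}
    (hv : IsUnitVector v) : (1 - ketbra v).PosSemidef := by
  have hK : ketbra v * ketbra v = ketbra v := by
    rw [ketbra, Matrix.vecMulVec_mul_vecMulVec, show dotProduct (star v) v = 1 from hv, one_smul]
  have hH : (ketbra v).conjTranspose = ketbra v := (ketbra_posSemidef v).isHermitian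
  have : 1 - ketbra v = (1 - ketbra v).conjTranspose * (1 - ketbra v) := by
    rw [Matrix.conjTranspose_sub, Matrix.conjTranspose_one, hH, mul_sub, sub_mul, sub_mul, hK]
    simp
  rw [this]
  exact Matrix.posSemidef_conjTranspose_mul_self _

/-- With `M` the coefficient matrix from `C` to `AB`, the difference is `M (1 - P) Mᴴ`, where `P`
projects onto the conjugate of `v`. Hence every partial inner product can start a decomposition of
the `AB` reduction. -/
lemma reduceAB_sub_posSemidef {v : C → ℂ} (hv : IsUnitVector v) (φ : A × (B × C) → ℂ) :
    (reduceAB (ketbra φ) - ketbra (partialInner v φ)).PosSemidef := by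
  have hv' : IsUnitVector (star v) := by
    rw [IsUnitVector, star_star, dotProduct_comm]
    exact hv
  have := (one_sub_ketbra_posSemidef hv').mul_mul_conjTranspose_same (coeffMatrixAB φ)
  rwa [Matrix.mul_sub, Matrix.sub_mul, Matrix.mul_one, ← reduceAB_ketbra, ← ketbra_mulVec] at this

/-- Conditioning `C` on `v` turns the blocks of the `AC` reduction into quadratic forms in `v`, so
knowing the conditional states for all `v` determines that reduction. -/
lemma traceRight_partialInner (v : C → ℂ) (φ : A × (B × C) → ℂ) (a a' : A) :
    traceRight (ketbra (partialInner v φ)) a a' =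
      dotProduct (star v) ((Matrix.of fun c c' => reduceAC (ketbra φ) (a, c) (a', c')).mulVec v) := by
  simp only [traceRight, ketbra, partialInner, coeffMatrixAB, reduceAC, Matrix.of_apply,
    Matrix.vecMulVec_apply, Matrix.mulVec, dotProduct, Pi.star_apply, star_sum, star_mul', star_star,
    Finset.mul_sum, Finset.sum_mul]
  conv_rhs => rw [Finset.sum_comm]
  rw [Finset.sum_comm]
  refine Finset.sum_congr rfl fun c _ => ?_
  rw [Finset.sum_comm]
  refine Finset.sum_congr rfl fun c' _ => Finset.sum_congr rfl fun b _ => ?_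
  ring

/-- Scaling extends the vanishing from unit vectors to all vectors, and complex polarisation then
gives the operator. -/
lemma eq_zero_of_quadratic_form {M : Matrix C C ℂ}
    (h : ∀ v : C → ℂ, IsUnitVector v → dotProduct (star v) (M.mulVec v) = 0) : M = 0 := by
  have h1 : Matrix.toEuclideanLin M = 0 := by
    rw [← inner_map_self_eq_zero]
    intro x
    by_cases hx : x = 0
    · simp [hx]
    · have hn : (‖x‖ : ℂ) ≠ 0 := by exact_mod_cast norm_ne_zero_iff.2 hx
      have h2 := h ((‖x‖ : ℂ)⁻¹ • x.ofLp) (by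
        have h3 := inner_self_eq_norm_sq_to_K (𝕜 := ℂ) x
        rw [EuclideanSpace.inner_eq_star_dotProduct, dotProduct_comm] at h3
        rw [IsUnitVector, star_smul, smul_dotProduct, dotProduct_smul, h3]
        simp
        field_simp)
      rw [star_smul, smul_dotProduct, Matrix.mulVec_smul, dotProduct_smul, smul_smul,
        smul_eq_mul] at h2
      have h4 := (mul_eq_zero.1 h2).resolve_left (by simpa using hn)
      rw [EuclideanSpace.inner_eq_star_dotProduct]
      have h5 := congrArg star h4
      rw [star_zero, Matrix.star_dotProduct, star_star] at h5
      rw [← h5]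
      exact dotProduct_comm _ _
  exact (LinearEquiv.map_eq_zero_iff _).1 h1

/-- If tracing out `C` does not decrease the entanglement of a pure state, then its reduction to
`AC` is a product. -/
lemma reduceAC_ketbra_mem_pureCone (hq : 1 < q) (hqs : 1 ≤ q * s) (φ : A × (B × C) → ℂ)
    (h : ∀ y, (reduceAB (ketbra φ), y) ∈ pureCone q s A B → pureHom q s φ ≤ y) :
    (reduceAC (ketbra φ), (0 : ℝ)) ∈ pureCone q s A C := by
  set T := traceRight (ketbra φ) with hT
  set R := reduceAC (ketbra φ) with hR
  have hTpsd : T.PosSemidef := traceRight_ketbra_posSemidef φ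
  have key : ∀ v : C → ℂ, IsUnitVector v →
      T.trace • traceRight (ketbra (partialInner v φ)) =
        (traceRight (ketbra (partialInner v φ))).trace • T := by
    intro v hv
    have hω := reduceAB_sub_posSemidef hv φ
    set ω := reduceAB (ketbra φ) - ketbra (partialInner v φ) with hωdef
    have hsum : reduceAB (ketbra φ) = ketbra (partialInner v φ) + ω := by
      rw [hωdef, add_sub_cancel]
    have hTsum : T = traceRight (ketbra (partialInner v φ)) + traceRight ω := by
      rw [← traceRight_add, ← hsum, traceRight_reduceAB]
    obtain ⟨y, hy⟩ := exists_mem_pureCone q s hω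
    obtain ⟨hωpsd, hyω⟩ := le_homEntropy_of_mem_pureCone hq hqs hy
    -- Minimality against the decomposition (`partialInner v φ`, then any one of `ω`) forces
    -- equality in superadditivity, so the conditional reduction is proportional to `T`.
    have h1 := h _ (by
      rw [hsum]
      exact add_mem (ketbra_mem_pureCone (partialInner v φ)) hy)
    have h2 := (homEntropy_add hq hqs (traceRight_ketbra_posSemidef (partialInner v φ)) hωpsd).2 (by
      rw [← hTsum]
      change pureHom q s φ ≤ pureHom q s (partialInner v φ) + _
      linarith)
    rw [hTsum, Matrix.trace_add, add_smul, h2, smul_add]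
  let N : Matrix C C ℂ := Matrix.of fun c c' => ∑ a, R (a, c) (a, c')
  have hN : ∀ v : C → ℂ, dotProduct (star v) (N.mulVec v) =
      (traceRight (ketbra (partialInner v φ))).trace := by
    intro v
    have h1 : N = ∑ a, Matrix.of fun c c' => R (a, c) (a, c') := by
      ext c c'
      simp [N, Matrix.sum_apply]
    rw [h1, Matrix.sum_mulVec, dotProduct_sum]
    exact Finset.sum_congr rfl fun a _ => (traceRight_partialInner v φ a a).symm
  have hNpsd : N.PosSemidef := by
    -- `N` is the reduction of `φ` to `C`, seen by reordering the tensor factors.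
    have h1 : N = traceRight (ketbra fun x : C × (A × B) => φ (x.2.1, (x.2.2, x.1))) := by
      ext c c'
      simp [N, hR, reduceAC, traceRight, ketbra, Matrix.vecMulVec_apply, Fintype.sum_prod_type]
    rw [h1]
    exact traceRight_ketbra_posSemidef _
  have hprod : T.trace • R = T ⊗ₖ N := by
    ext ⟨a, c⟩ ⟨a', c'⟩
    have h0 : T.trace • (Matrix.of fun c c' => R (a, c) (a', c')) - T a a' • N = 0 := by
      refine eq_zero_of_quadratic_form fun v hv => ?_
      have h1 := congrFun (congrFun (key v hv) a) a'
      rw [Matrix.smul_apply, Matrix.smul_apply, traceRight_partialInner, ← hN, smul_eq_mul,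
        smul_eq_mul] at h1
      rw [Matrix.sub_mulVec, dotProduct_sub, Matrix.smul_mulVec, Matrix.smul_mulVec,
        dotProduct_smul, dotProduct_smul, smul_eq_mul, smul_eq_mul, h1]
      ring
    have h2 := congrFun (congrFun h0 c) c'
    simp only [Matrix.sub_apply, Matrix.smul_apply, Matrix.of_apply, Matrix.zero_apply,
      sub_eq_zero] at h2
    exact h2
  by_cases h0 : T.trace = 0
  · rw [hT, trace_traceRight, (ketbra_posSemidef φ).trace_eq_zero_iff] at h0
    have : R = 0 := by
      ext
      simp [hR, h0, reduceAC]
    rw [this]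
    exact zero_mem _
  · have h1 : R = (((T.trace.re)⁻¹ : ℝ) : ℂ) • (T ⊗ₖ N) := by
      rw [← hprod, smul_smul, Complex.ofReal_inv, PosSemidef.coe_trace_re hTpsd,
        inv_mul_cancel₀ h0, one_smul]
    have h2 := smul_mem_pureCone (inv_nonneg.2 (PosSemidef.trace_re_nonneg hTpsd))
      (kronecker_mem_pureCone (q := q) (s := s) (by positivity) hTpsd hNpsd)
    rwa [← h1, mul_zero] at h2

/-- Minimality of a sum passes to the summands: if one could be improved on `AB`, combining it with
a reduced decomposition of the other, which costs no more, would improve the sum. -/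
lemma reduceAC_mem_pureCone (hq : 1 < q) (hqs : 1 ≤ q * s)
    {ρ : Matrix (A × (B × C)) (A × (B × C)) ℂ} {x : ℝ} (h : (ρ, x) ∈ pureCone q s A (B × C))
    (hmin : ∀ y, (reduceAB ρ, y) ∈ pureCone q s A B → x ≤ y) :
    (reduceAC ρ, (0 : ℝ)) ∈ pureCone q s A C := by
  induction h using pureCone_induction with
  | pure φ => exact reduceAC_ketbra_mem_pureCone hq hqs φ hmin
  | zero =>
    have : reduceAC (0 : Matrix (A × (B × C)) (A × (B × C)) ℂ) = 0 := by
      ext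
      simp [reduceAC]
    rw [this]
    exact zero_mem _
  | add ρ x σ y hx hy h1 h2 =>
    have hAC : reduceAC (ρ + σ) = reduceAC ρ + reduceAC σ := by
      ext
      simp [reduceAC, Finset.sum_add_distrib]
    obtain ⟨x', hx', hρ⟩ := exists_reduceAB_mem_pureCone hq hqs hx
    obtain ⟨y', hy', hσ⟩ := exists_reduceAB_mem_pureCone hq hqs hy
    rw [reduceAB_add] at hmin
    rw [hAC, ← add_zero (0 : ℝ)]
    refine add_mem (h1 fun z hz => ?_) (h2 fun z hz => ?_)
    · linarith [hmin _ (add_mem hz hσ)]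
    · linarith [hmin _ (add_mem hρ hz)]

lemma isMonogamous_unifiedEntanglement (hq : 1 < q) (hqs : 1 ≤ q * s) :
    IsMonogamous (unifiedEntanglement.{u} q s) := by
  intro A B C _ _ _ _ _ _ ρ hρ h
  have hmem := hρ.unifiedEntanglement_mem hq hqs
  have htr : (reduceAB ρ).trace = ρ.trace := by
    simp [Matrix.trace, reduceAB, Fintype.sum_prod_type]
  have htr' : (reduceAC ρ).trace = ρ.trace := by
    simp only [Matrix.trace, reduceAC, Fintype.sum_prod_type, Matrix.diag_apply, Matrix.of_apply]
    exact Finset.sum_congr rfl fun a _ => Finset.sum_comm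
  obtain ⟨y, -, hy⟩ := exists_reduceAB_mem_pureCone hq hqs hmem
  have hAB : IsState (reduceAB ρ) := ⟨posSemidef_of_mem_pureCone hy, htr.trans hρ.2⟩
  have hAC := reduceAC_mem_pureCone hq hqs hmem fun z hz => h ▸ hAB.unifiedEntanglement_le hq hqs hz
  have hACs : IsState (reduceAC ρ) := ⟨posSemidef_of_mem_pureCone hAC, htr'.trans hρ.2⟩
  exact hACs.unifiedEntanglement_eq_zero hq hqs hAC

end monogamy

/-! ### Continuity -/

/-! ### Square roots and pseudo-inverses by functional calculus -/

section functionalCalculus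

variable {X : Type*} [Fintype X] [DecidableEq X]

/-- No continuity of `f` or `g` is needed because the spectrum is finite; this allows the
discontinuous function `(√x)⁻¹`. -/
lemma cfc_mul_cfc (f g : ℝ → ℝ) (ρ : Matrix X X ℂ) :
    cfc f ρ * cfc g ρ = cfc (fun x => f x * g x) ρ := by
  rw [cfc_mul f g ρ (by rw [continuousOn_iff_continuous_domRestrict]; fun_prop)
    (by rw [continuousOn_iff_continuous_domRestrict]; fun_prop)]

lemma cfc_congr_of_posSemidef {f g : ℝ → ℝ} {ρ : Matrix X X ℂ} (hρ : ρ.PosSemidef)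
    (h : ∀ x, 0 ≤ x → f x = g x) : cfc f ρ = cfc g ρ := by
  refine cfc_congr fun x hx => h x ?_
  rw [hρ.isHermitian.spectrum_real_eq_range_eigenvalues] at hx
  obtain ⟨i, rfl⟩ := hx
  exact hρ.eigenvalues_nonneg i

lemma conjTranspose_cfc (f : ℝ → ℝ) (ρ : Matrix X X ℂ) : (cfc f ρ).conjTranspose = cfc f ρ :=
  (cfc_predicate f ρ : IsSelfAdjoint (cfc f ρ))

/-- A square root `S`, its pseudo-inverse `R` and the projection `Q` onto the kernel. -/
lemma sqrt_identities {ρ : Matrix X X ℂ} (hρ : ρ.PosSemidef) :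
    let S := cfc Real.sqrt ρ
    let R := cfc (fun x : ℝ => (√x)⁻¹) ρ
    let Q := cfc (fun x : ℝ => 1 - √x * (√x)⁻¹) ρ
    S * S = ρ ∧ S * R + Q = 1 ∧ S * Q = 0 ∧ Q * ρ * Q = 0 ∧ R * ρ * R + Q * Q = 1 := by
  have hid : cfc (fun x : ℝ => x) ρ = ρ := cfc_id' ℝ ρ hρ.isHermitian
  have hone : cfc (fun _ : ℝ => (1 : ℝ)) ρ = 1 := cfc_const_one ℝ ρ hρ.isHermitian
  have hadd : ∀ f g : ℝ → ℝ, cfc f ρ + cfc g ρ = cfc (fun x => f x + g x) ρ := fun f g => by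
    rw [cfc_add (a := ρ) f g (by rw [continuousOn_iff_continuous_domRestrict]; fun_prop)
      (by rw [continuousOn_iff_continuous_domRestrict]; fun_prop)]
  have hzero : cfc (fun _ : ℝ => (0 : ℝ)) ρ = 0 := cfc_const_zero ℝ ρ
  have hcases : ∀ x : ℝ, 0 ≤ x → (√x = 0 ∧ x = 0) ∨ (√x * (√x)⁻¹ = 1) := by
    intro x hx
    by_cases h0 : √x = 0
    · exact Or.inl ⟨h0, (Real.sqrt_eq_zero hx).1 h0⟩
    · exact Or.inr (mul_inv_cancel₀ h0)
  intro S R Q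
  have hSS : S * S = ρ := by
    rw [cfc_mul_cfc]
    conv_rhs => rw [← hid]
    exact cfc_congr_of_posSemidef hρ fun x hx => Real.mul_self_sqrt hx
  have hSQ : S * Q = 0 := by
    rw [cfc_mul_cfc, ← hzero]
    refine cfc_congr_of_posSemidef hρ fun x hx => ?_
    rcases hcases x hx with ⟨h, -⟩ | h
    · rw [h, zero_mul]
    · rw [h, sub_self, mul_zero]
  refine ⟨hSS, ?_, hSQ, ?_, ?_⟩
  · rw [cfc_mul_cfc, hadd, ← hone]
    exact cfc_congr_of_posSemidef hρ fun x hx => by ring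
  · rw [← hSS, mul_assoc, mul_assoc, hSQ, mul_zero, mul_zero]
  · have h1 : R * ρ * R = R * S * (S * R) := by
      rw [← hSS]
      simp only [mul_assoc]
    rw [h1, cfc_mul_cfc, cfc_mul_cfc, cfc_mul_cfc, cfc_mul_cfc, hadd, ← hone]
    refine cfc_congr_of_posSemidef hρ fun x hx => ?_
    rcases hcases x hx with ⟨h, -⟩ | h
    · simp [h]
    · rw [mul_comm (√x)⁻¹, h]
      norm_num

end functionalCalculus

/-! ### Semicontinuity of the convex roof from both sides -/

section continuity

variable {A B : Type u} [Fintype A] [DecidableEq A] [Fintype B] [DecidableEq B] {q s : ℝ}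

lemma continuousOn_homEntropy {X : Type u} [Fintype X] [DecidableEq X] (hq : 1 < q)
    (hqs : 1 ≤ q * s) : ContinuousOn (homEntropy q s (X := X)) {ρ | ρ.PosSemidef} := by
  have htr : Continuous fun ρ : Matrix X X ℂ => ρ.trace.re :=
    Complex.continuous_re.comp continuous_id.matrix_trace
  intro ρ₀ hρ₀
  -- Normalisation is singular at zero, but there the function is squeezed between zero and a
  -- multiple of the trace.
  by_cases h0 : ρ₀ = 0
  · subst h0
    rw [ContinuousWithinAt, homEntropy_zero]
    have h1 : Filter.Tendsto (fun ρ : Matrix X X ℂ => ρ.trace.re * (1 / ((q - 1) * s)))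
        (nhdsWithin 0 {ρ | ρ.PosSemidef}) (nhds 0) := by
      have : Continuous fun ρ : Matrix X X ℂ => ρ.trace.re * (1 / ((q - 1) * s)) :=
        htr.mul continuous_const
      have h2 := this.continuousWithinAt (s := {ρ : Matrix X X ℂ | ρ.PosSemidef}) (x := 0)
      rwa [ContinuousWithinAt, Matrix.trace_zero, Complex.zero_re, zero_mul] at h2
    refine tendsto_of_tendsto_of_tendsto_of_le_of_le' tendsto_const_nhds h1 ?_ ?_
    · filter_upwards [self_mem_nhdsWithin] with ρ hρ using homEntropy_nonneg hq hqs hρ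
    · filter_upwards [self_mem_nhdsWithin] with ρ hρ using homEntropy_le hq hqs hρ
  · have htr0 : ρ₀.trace.re ≠ 0 := fun h => h0 (PosSemidef.eq_zero_of_trace_re hρ₀ h)
    refine ContinuousWithinAt.mono_of_mem_nhdsWithin
      (t := {ρ : Matrix X X ℂ | ρ.PosSemidef} ∩ {ρ | ρ.trace.re ≠ 0}) ?_ ?_
    · refine htr.continuousWithinAt.mul ?_
      have h1 : ContinuousWithinAt (fun ρ : Matrix X X ℂ => ((ρ.trace.re⁻¹ : ℝ) : ℂ) • ρ)
          ({ρ : Matrix X X ℂ | ρ.PosSemidef} ∩ {ρ | ρ.trace.re ≠ 0}) ρ₀ := by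
        refine ContinuousWithinAt.smul (f := fun ρ : Matrix X X ℂ => ((ρ.trace.re⁻¹ : ℝ) : ℂ))
          (g := fun ρ => ρ) ?_ continuousWithinAt_id
        exact Complex.continuous_ofReal.continuousAt.comp_continuousWithinAt
          (htr.continuousWithinAt.inv₀ htr0)
      refine ContinuousWithinAt.comp (g := unifiedEntropy q s) (t := {ρ : Matrix X X ℂ | IsState ρ})
        (continuousOn_unifiedEntropy hq hqs _ (PosSemidef.isState_normalize hρ₀ h0)) h1 ?_
      rintro ρ ⟨hρ, hρ0⟩
      refine PosSemidef.isState_normalize hρ ?_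
      rintro rfl
      simp at hρ0
    · refine Filter.inter_mem self_mem_nhdsWithin (mem_nhdsWithin_of_mem_nhds ?_)
      exact (isOpen_ne_fun htr continuous_const).mem_nhds htr0

lemma continuous_pureHom (hq : 1 < q) (hqs : 1 ≤ q * s) :
    Continuous (pureHom q s (A := A) (B := B)) :=
  (continuousOn_homEntropy hq hqs).comp_continuous (continuous_traceRight.comp continuous_ketbra)
    traceRight_ketbra_posSemidef

lemma exists_decomposition {ρ : Matrix (A × B) (A × B) ℂ} {x : ℝ}
    (h : (ρ, x) ∈ pureCone q s A B) :
    ∃ (ι : Type) (_ : Fintype ι) (φ : ι → A × B → ℂ),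
      ρ = ∑ i, ketbra (φ i) ∧ x = ∑ i, pureHom q s (φ i) := by
  induction h using pureCone_induction with
  | pure φ => exact ⟨Unit, inferInstance, fun _ => φ, by simp, by simp⟩
  | zero => exact ⟨Empty, inferInstance, Empty.elim, by simp, by simp⟩
  | add ρ x σ y _ _ h1 h2 =>
    obtain ⟨ι, _, φ, rfl, rfl⟩ := h1
    obtain ⟨κ, _, ψ, rfl, rfl⟩ := h2
    exact ⟨ι ⊕ κ, inferInstance, Sum.elim φ ψ, by simp, by simp⟩

/-- A decomposition of `ρ₀` extends to a continuous family of decompositions of all states. -/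
lemma exists_continuous_family (hq : 1 < q) (hqs : 1 ≤ q * s) {ρ₀ : Matrix (A × B) (A × B) ℂ}
    {x : ℝ} (hρ₀ : IsState ρ₀) (h : (ρ₀, x) ∈ pureCone q s A B) :
    ∃ F : Matrix (A × B) (A × B) ℂ → ℝ, ContinuousOn F {ρ | IsState ρ} ∧ F ρ₀ = x ∧
      ∀ ρ, IsState ρ → (ρ, F ρ) ∈ pureCone q s A B := by
  obtain ⟨ι, _, φ, hφ, hx⟩ := exists_decomposition h
  obtain ⟨-, hSR, hSQ, hQQ, hRQ⟩ := sqrt_identities hρ₀.1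
  set R := cfc (fun x : ℝ => (√x)⁻¹) ρ₀
  set Q := cfc (fun x : ℝ => 1 - √x * (√x)⁻¹) ρ₀
  have hR : R.conjTranspose = R := conjTranspose_cfc _ _
  have hQ : Q.conjTranspose = Q := conjTranspose_cfc _ _
  let S : Matrix (A × B) (A × B) ℂ → Matrix (A × B) (A × B) ℂ := fun ρ => cfc Real.sqrt ρ
  have hcol : ∑ i, ketbra (Q.mulVec (Pi.single i 1)) = Q * Q := by
    have h1 : ∑ i, ketbra (Pi.single i 1 : A × B → ℂ) = 1 := by
      ext j k
      simp [Matrix.sum_apply, ketbra, Matrix.vecMulVec_apply, Pi.single_apply, Matrix.one_apply]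
    simp only [ketbra_mulVec]
    rw [← Matrix.sum_mul, ← Matrix.mul_sum, h1, hQ, Matrix.mul_one]
  -- The vectors of a decomposition lie in the support of `ρ₀`, since the nonnegative traces of
  -- their compressions to the kernel sum to zero.
  have hker : ∀ i, Q.mulVec (φ i) = 0 := by
    have h1 : ∑ i, ketbra (Q.mulVec (φ i)) = 0 := by
      simp only [ketbra_mulVec]
      rw [← Matrix.sum_mul, ← Matrix.mul_sum, ← hφ, hQ, hQQ]
    have h2 : ∑ i, (ketbra (Q.mulVec (φ i))).trace = 0 := by
      rw [← Matrix.trace_sum, h1, Matrix.trace_zero]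
    intro i
    have h3 := (Finset.sum_eq_zero_iff_of_nonneg
      fun i _ => (ketbra_posSemidef (Q.mulVec (φ i))).trace_nonneg).1 h2 i (Finset.mem_univ i)
    rwa [trace_ketbra, dotProduct_star_self_eq_zero] at h3
  -- The vectors `√ρ R φ_i` and `√ρ Q e_i` decompose `ρ` because `R ρ₀ R + Q Q = 1`. At `ρ₀` the
  -- former are the original `φ_i` and the latter vanish.
  refine ⟨fun ρ => ∑ i, pureHom q s ((S ρ).mulVec (R.mulVec (φ i))) +
    ∑ i, pureHom q s ((S ρ).mulVec (Q.mulVec (Pi.single i 1))), ?_, ?_, ?_⟩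
  · have hS : ContinuousOn S {ρ | IsState ρ} :=
      continuousOn_cfc_states Real.continuous_sqrt.continuousOn
    have hterm : ∀ w : A × B → ℂ,
        ContinuousOn (fun ρ => pureHom q s ((S ρ).mulVec w)) {ρ | IsState ρ} := fun w =>
      (continuous_pureHom hq hqs).comp_continuousOn
        ((continuous_id.matrix_mulVec continuous_const).comp_continuousOn hS)
    exact (continuousOn_finsetSum _ fun i _ => hterm _).add
      (continuousOn_finsetSum _ fun i _ => hterm _)
  · have h1 : ∀ i, (S ρ₀).mulVec (R.mulVec (φ i)) = φ i := by
      intro i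
      have := congrArg (fun M => Matrix.mulVec M (φ i)) hSR
      simpa [Matrix.add_mulVec, hker, ← Matrix.mulVec_mulVec] using this
    have h2 : ∀ i, (S ρ₀).mulVec (Q.mulVec (Pi.single i 1)) = 0 := by
      intro i
      rw [Matrix.mulVec_mulVec, show S ρ₀ * Q = 0 from hSQ, Matrix.zero_mulVec]
    have h3 : pureHom q s (0 : A × B → ℂ) = 0 := by
      have : ketbra (0 : A × B → ℂ) = 0 := by simp [ketbra]
      rw [pureHom, this, traceRight_zero, homEntropy_zero]
    simp only [h1, h2, h3, Finset.sum_const_zero, add_zero, hx]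
  · intro ρ hρ
    have h1 : ρ = ∑ i, ketbra ((S ρ).mulVec (R.mulVec (φ i))) +
        ∑ i, ketbra ((S ρ).mulVec (Q.mulVec (Pi.single i 1))) := by
      have h2 : ∑ i, ketbra (R.mulVec (φ i)) = R * ρ₀ * R := by
        simp only [ketbra_mulVec]
        rw [← Matrix.sum_mul, ← Matrix.mul_sum, ← hφ, hR]
      have hS : (S ρ).conjTranspose = S ρ := conjTranspose_cfc _ _
      simp only [ketbra_mulVec (S ρ)]
      rw [← Matrix.sum_mul, ← Matrix.mul_sum, ← Matrix.sum_mul, ← Matrix.mul_sum, h2, hcol,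
        ← Matrix.add_mul, ← Matrix.mul_add, hRQ, Matrix.mul_one, hS]
      exact (sqrt_identities hρ.1).1.symm
    conv => enter [2, 1]; rw [h1]
    exact add_mem (sum_mem_pureCone _ fun i => ketbra_mem_pureCone _)
      (sum_mem_pureCone _ fun i => ketbra_mem_pureCone _)

lemma isContinuous_unifiedEntanglement (hq : 1 < q) (hqs : 1 ≤ q * s) :
    IsContinuous (unifiedEntanglement.{u} q s) := by
  intro A B _ _ _ _
  rw [continuousOn_iff_lower_upperSemicontinuousOn]
  constructor
  · rw [lowerSemicontinuousOn_iff_preimage_Iic]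
    intro a
    -- Since the minimum is attained, the sublevel set is, among states, the projection of a compact
    -- slice of the hull.
    refine ⟨Prod.fst '' (convexHull ℝ (pureGraph q s A B) ∩ {z | z.2 ≤ a}),
      (((isCompact_convexHull_of_finiteDimensional (isCompact_pureGraph hq hqs)).inter_right
        (isClosed_le continuous_snd continuous_const)).image continuous_fst).isClosed, ?_⟩
    ext ρ
    refine and_congr_right fun hρ => ⟨fun h => ?_, ?_⟩
    · exact ⟨_, ⟨hρ.mem_pureCone_iff.1 (hρ.unifiedEntanglement_mem hq hqs), h⟩, rfl⟩
    · rintro ⟨⟨σ, x⟩, ⟨h, hx⟩, rfl⟩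
      exact (IsState.unifiedEntanglement_le hq hqs hρ (convexHull_subset_pureCone h)).trans hx
  · intro ρ₀ hρ₀ a ha
    -- `F` is a continuous upper bound for the entanglement on all states, and it is exact at `ρ₀`.
    obtain ⟨F, hF, hF0, hFmem⟩ :=
      exists_continuous_family hq hqs hρ₀ (hρ₀.unifiedEntanglement_mem hq hqs)
    have h1 := (hF ρ₀ hρ₀).eventually (isOpen_Iio.mem_nhds (show F ρ₀ < a from hF0 ▸ ha))
    filter_upwards [h1, self_mem_nhdsWithin] with ρ hρa hρ
    exact (hρ.unifiedEntanglement_le hq hqs (hFmem ρ hρ)).trans_lt hρa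

end continuity

end UnifiedEntanglement

theorem theorem1 (q s : ℝ) (hq : 1 < q) (hqs : 1 ≤ q * s) :
    (∀ (A B : Type u) [Fintype A] [DecidableEq A] [Fintype B] [DecidableEq B]
      (ρ : Matrix (A × B) (A × B) ℂ), UnifiedEntanglement.IsState ρ →
      IsLeast
        (UnifiedEntanglement.ensembleAverages
          (UnifiedEntanglement.pureUnifiedEntanglement q s (A := A) (B := B)) ρ)
        (UnifiedEntanglement.unifiedEntanglement q s A B ρ)) ∧
    UnifiedEntanglement.IsContinuous (UnifiedEntanglement.unifiedEntanglement.{u} q s) ∧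
    UnifiedEntanglement.IsEntanglementMonotone
      (UnifiedEntanglement.unifiedEntanglement.{u} q s) ∧
    UnifiedEntanglement.IsMonogamous (UnifiedEntanglement.unifiedEntanglement.{u} q s) := by
  exact ⟨fun _ _ _ _ _ _ _ hρ => hρ.isLeast hq hqs,
    UnifiedEntanglement.isContinuous_unifiedEntanglement hq hqs,
    UnifiedEntanglement.isEntanglementMonotone_unifiedEntanglement hq hqs,
    UnifiedEntanglement.isMonogamous_unifiedEntanglement hq hqs⟩
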